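/- **Proposition.** Let $0<\alpha<1$, $\tau>0$, $\lambda\in\mathbb C$, and let $\varphi:[-\tau,0]\to\mathbb C$ and $f:[0,\infty)\to\mathbb C$ be continuous (in particular, they may be real-valued). Consider the linear fractional delay differential equation $$ {}^{C}\!D_0^\alpha y(t)=\lambda\,y(t-\tau)+f(t)\quad(t>0),\qquad y(t)=\varphi(t)\quad(-\tau\le t\le 0), \tag{1} $$ where $J_0^{a}y(t)=\frac1{\Gamma(a)}\int_0^t(t-r)^{a-1}y(r)\,dr$ and ${}^{C}\!D_0^\alpha y=J_0^{1-\alpha}y'$. A *Caputo solution* of (1) is a continuous $y:[-\tau,\infty)\to\mathbb C$ with $y=\varphi$ on $[-\tau,0]$ that is absolutely continuous on every $[0,T]$ and satisfies the equation for almost every $t>0$. A *continuous solution* is a continuous $y:[-\tau,\infty)\to\mathbb C$ with $y=\varphi$ on $[-\tau,0]$ that satisfies the equation for every $t>0$, with the Caputo derivative of a continuous function understood as $\frac{d}{dt}J_0^{1-\alpha}(y-y(0))(t)$. Put $$ \mathcal J_{0,\tau,\lambda}f(t)=\sum_{k=0}^{\lfloor t/\tau\rfloor}\frac{\lambda^k}{\Gamma(\alpha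 k+\alpha)}\int_0^{t-k\tau}(t-k\tau-r)^{\alpha k+\alpha-1}f(r)\,dr , \qquad P_\tau(s;\varphi)=\varphi(0)+s\int_{-\tau}^0e^{-sr}\varphi(r)\,dr . $$ There is exactly one tempered distribution $p_\tau=p_\tau(\cdot\,;\varphi)$ on $\mathbb R$, supported in $[0,\infty)$, whose Laplace transform is $e^{-s\tau}P_\tau(s;\varphi)$ for $\operatorname{Re}s>0$ (the inverse Laplace transform). For every $\beta=(k+1)\alpha$, $k=0,1,2,\dots$, the convolution of $p_\tau$ with the function equal to $r^{\beta}$ for $r>0$ and to $0$ for $r\le0$ is a continuous function; its value at $x\ge 0$ is denoted $\int_0^{x}(x-r)^\beta p_\tau(r;\varphi)\,dr$. The following hold. 1. Problem (1) has exactly one continuous solution $y$, and for every $t\ge0$, with $y_0=\varphi(0)$, $$ y(t)=y_0+\sum_{k=0}^{\lfloor t/\tau\rfloor}\frac{\lambda^{k+1}}{\Gamma((k+1)\alpha+1)}\int_0^{t-k\tau}(t-k\tau-r)^{(k+1)\alpha}\,p_\tau(r;\varphi)\,dr+\mathcal J_{0,\tau,\lambda}f(t). \tag{2} $$ 2. Every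 Caputo solution of (1) equals this $y$, and hence is given by (2). Conversely, if this $y$ is absolutely continuous on every $[0,T]$, then it is a Caputo solution. 3. Suppose that there are $a\in\mathbb C$, $\sigma\in\mathbb R$ and $g:(0,\infty)\to\mathbb C$ such that, for all $s$ with $\operatorname{Re}s>\sigma$, the function $e^{-sr}g(r)$ is integrable on $(0,\infty)$ and $a+\int_0^\infty e^{-sr}g(r)\,dr=e^{-s\tau}P_\tau(s;\varphi)$ (that is, $p_\tau=a\,\delta_0+g$; for $a=0$, $p_\tau$ is the function $g$). Then (2) holds for all $t\ge0$ with each integral in the sum over $k$ replaced by $a\,(t-k\tau)^{(k+1)\alpha}+\int_0^{t-k\tau}(t-k\tau-r)^{(k+1)\alpha}g(r)\,dr$. -/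

import Mathlib

open Set MeasureTheory
open scoped SchwartzMap

namespace FDDE

noncomputable section

/-- The Riemann--Liouville integral `J_0^a y (t) = Γ(a)⁻¹ ∫_0^t (t - r)^(a-1) y(r) dr`. -/
def rlIntegral (a : ℝ) (y : ℝ → ℂ) (t : ℝ) : ℂ :=
  (1 / (Real.Gamma a : ℂ)) * ∫ r in (0 : ℝ)..t, (((t - r) ^ (a - 1) : ℝ) : ℂ) * y r

/-- The Caputo derivative of order `0 < α < 1`: `J_0^(1-α) y'`. -/
def caputoDeriv (α : ℝ) (y : ℝ → ℂ) (t : ℝ) : ℂ :=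
  rlIntegral (1 - α) (deriv y) t

/-- Absolute continuity on every interval `[0, T]`. -/
def LocallyAC (y : ℝ → ℂ) : Prop :=
  ∀ T : ℝ, 0 < T → AbsolutelyContinuousOnInterval y 0 T

/-- `y` is continuous on `[-τ, ∞)` and has the history `φ` on `[-τ, 0]`. -/
def HasHistory (τ : ℝ) (φ y : ℝ → ℂ) : Prop :=
  ContinuousOn y (Ici (-τ)) ∧ EqOn y φ (Icc (-τ) 0)

/-- `y` solves `ᶜD_0^α y(t) = lam y(t-τ) + f(t)` with history `φ`, where `ᶜD_0^α y = J_0^(1-α) y'`: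
`y` is locally absolutely continuous on `[0, ∞)`, so that `y'` is locally integrable and
`J_0^(1-α) y'` exists almost everywhere, and the equation holds for almost every `t > 0`. -/
def IsCaputoSolution (α τ : ℝ) (lam : ℂ) (φ f y : ℝ → ℂ) : Prop :=
  HasHistory τ φ y ∧ LocallyAC y ∧
    ∀ᵐ t ∂(volume.restrict (Ioi (0 : ℝ))), caputoDeriv α y t = lam * y (t - τ) + f t

/-- `y` is a continuous solution of the same problem, where the Caputo derivative of a function
that is merely continuous is `(d/dt) J_0^(1-α) (y - y(0))`; the equation holds for every `t > 0`. -/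
def IsContinuousSolution (α τ : ℝ) (lam : ℂ) (φ f y : ℝ → ℂ) : Prop :=
  HasHistory τ φ y ∧
    ∀ t : ℝ, 0 < t →
      HasDerivAt (rlIntegral (1 - α) (fun r => y r - y 0)) (lam * y (t - τ) + f t) t

/-- The generalized integral
`∑_{k=0}^{⌊t/τ⌋} lam^k / Γ(α k + α) ∫_0^(t-kτ) (t - kτ - r)^(α k + α - 1) f(r) dr`. -/
def genIntegral (α τ : ℝ) (lam : ℂ) (f : ℝ → ℂ) (t : ℝ) : ℂ :=
  ∑ k ∈ Finset.range (⌊t / τ⌋₊ + 1),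
    lam ^ k / (Real.Gamma (α * k + α) : ℂ) *
      ∫ r in (0 : ℝ)..(t - k * τ), (((t - k * τ - r) ^ (α * k + α - 1) : ℝ) : ℂ) * f r

/-- `e^(-sτ) (φ(0) + s ∫_{-τ}^0 e^(-sr) φ(r) dr)`. -/
def historyTransform (τ : ℝ) (φ : ℝ → ℂ) (s : ℂ) : ℂ :=
  Complex.exp (-s * τ) *
    (φ 0 + s * ∫ r in (-τ)..(0 : ℝ), Complex.exp (-s * r) * φ r)

/-- `p` is the inverse Laplace transform of `F`: `p` is a tempered distribution supported in
`[0, ∞)` (it vanishes on `(-∞, 0)`) whose Laplace transform `⟨p, e^(-s·)⟩` is `F s` for `Re s > 0`. Since `e^(-s·)` is not a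
Schwartz function on the whole line, it is replaced by any Schwartz function that agrees with it
on a neighbourhood of `[0, ∞)`; the value does not depend on the choice, by the support
condition. -/
def IsInverseLaplace (p : 𝓢'(ℝ, ℂ)) (F : ℂ → ℂ) : Prop :=
  Distribution.IsVanishingOn p (Iio 0) ∧
    ∀ s : ℂ, 0 < s.re → ∀ ψ : 𝓢(ℝ, ℂ),
      (∃ ε > 0, ∀ t : ℝ, -ε < t → ψ t = Complex.exp (-s * t)) → p ψ = F s

/-- The continuous function `c` is the convolution of `p` (supported in `[0, ∞)`) with the truncated
power `t ↦ t^β` for `t > 0`, `0` for `t ≤ 0`; that is, `c x` is `∫_0^x (x - r)^β p(r) dr` in the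
sense of distributions:
`⟨c, ψ⟩ = ⟨p_r, ∫_r^∞ (x - r)^β ψ(x) dx⟩` for every test function `ψ`. As for the Laplace
transform, the smooth function of `r` that `p` is applied to is replaced by any Schwartz function
`Θ` that agrees with it on a neighbourhood of `[0, ∞)`. -/
def IsPowerConvolution (p : 𝓢'(ℝ, ℂ)) (β : ℝ) (c : ℝ → ℂ) : Prop :=
  Continuous c ∧
    ∀ ψ Θ : 𝓢(ℝ, ℂ), HasCompactSupport ψ →
      (∃ ε > 0, ∀ r : ℝ, -ε < r → Θ r = ∫ x in Ioi r, (((x - r) ^ β : ℝ) : ℂ) * ψ x) →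
        p Θ = ∫ x, c x * ψ x

end

end FDDE

/-! Everything is expressed through the delayed history Ψ(r) = φ(min(r - τ, 0)) on [0,∞), a bounded
continuous function (`shiftedHistory`). Splitting its Laplace integral at r = τ shows that s times
its Laplace transform is e^{-sτ} P_τ(s; φ) (`laplace_shiftedHistory`). Hence p_τ is the
distributional derivative of Ψ extended by zero, and convolving it with the truncated power of
exponent β gives Γ(β+1) J^β Ψ (`isPowerConvolution_rlExt`). With w = λΨ + f, formula (2) becomes
y(t) = φ(0) + ∑_k λ^k J^{(k+1)α} w (t - kτ).

For a continuous function with the given history, the equation is equivalent to the Volterra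
equation y - y(0) = J^α(λ y(· - τ) + f) (`hasDerivAt_rlIntegral_iff`), by the semigroup law J^a J^b
= J^{a+b}. The series solves it because J^α commutes with delays and raises each order by α, so that
applying λ J^α after a delay by τ sends the k-th term to the next one (`rlIntegral_add_delaySum`).
Uniqueness follows by the method of steps: on each interval of length τ the right-hand side is
already known. For absolutely continuous y, J^{1-α}(y - y(0)) is the primitive of J^{1-α} y', so the
Caputo and the continuous notions differ only by that regularity.

Uniqueness of p_τ is a Lerch theorem for distributions. By Weierstrass approximation in the variable
x = e^{-t}, finite sums of e^{-(n+1)t} approximate a test function and its derivatives with weight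
e^{-t} on [-2,∞); after a cutoff to the left of 0 this is convergence in the Schwartz space, so a
distribution supported in [0,∞) that kills these exponentials is zero
(`eq_zero_of_forall_laplace_eq_zero`). The same approximation proves Lerch's theorem for continuous
functions. When p_τ = aδ₀ + g it gives a + ∫₀ˣ g = Ψ(x), and J^β of this identity is the third
claim. -/

namespace FDDE

open Filter Topology

/-! ### Approximation by exponential sums -/

/-- The exponential sum `∑ n < N, a n * exp (-(n + 1) t)`. -/
noncomputable def expSum (N : ℕ) (a : ℕ → ℂ) (t : ℝ) : ℂ :=
  ∑ n ∈ Finset.range N, a n * Complex.exp (-((n : ℂ) + 1) * t)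

theorem hasDerivAt_expSum (N : ℕ) (a : ℕ → ℂ) (t : ℝ) :
    HasDerivAt (expSum N a) (expSum N (fun n => a n * (-((n : ℂ) + 1))) t) t := by
  unfold expSum
  refine HasDerivAt.fun_sum fun n _ => ?_
  have h1 : HasDerivAt (fun t : ℝ => -((n : ℂ) + 1) * (t : ℂ)) (-((n : ℂ) + 1)) t := by
    simpa using (Complex.ofRealCLM.hasDerivAt (x := t)).const_mul (-((n : ℂ) + 1))
  have h2 := (h1.cexp).const_mul (a n)
  exact h2.congr_deriv (by ring)

theorem deriv_expSum (N : ℕ) (a : ℕ → ℂ) :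
    deriv (expSum N a) = expSum N (fun n => a n * (-((n : ℂ) + 1))) :=
  funext fun t => (hasDerivAt_expSum N a t).deriv

theorem iteratedDeriv_expSum (N : ℕ) (j : ℕ) (a : ℕ → ℂ) :
    iteratedDeriv j (expSum N a) = expSum N (fun n => a n * (-((n : ℂ) + 1)) ^ j) := by
  induction j with
  | zero => simp
  | succ j ih =>
    rw [iteratedDeriv_succ, ih, deriv_expSum]
    congr 1
    ext n
    ring

theorem contDiff_expSum (N : ℕ) (a : ℕ → ℂ) : ContDiff ℝ ((⊤ : ℕ∞) : WithTop ℕ∞) (expSum N a) := by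
  unfold expSum
  refine ContDiff.sum fun n _ => ?_
  refine contDiff_const.mul ?_
  exact (contDiff_const.mul Complex.ofRealCLM.contDiff).cexp

/-- Decay at infinity makes it possible to recover lower derivatives from higher ones by integrating
from infinity. -/
theorem tendsto_expSum (N : ℕ) (a : ℕ → ℂ) : Tendsto (expSum N a) atTop (𝓝 0) := by
  have : Tendsto (expSum N a) atTop (𝓝 (∑ n ∈ Finset.range N, a n * 0)) := by
    unfold expSum
    refine tendsto_finsetSum _ fun n _ => Tendsto.const_mul _ ?_
    rw [tendsto_zero_iff_norm_tendsto_zero]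
    have h1 : Tendsto (fun t : ℝ => ((n : ℝ) + 1) * t) atTop atTop :=
      tendsto_id.const_mul_atTop (by positivity)
    refine (Real.tendsto_exp_neg_atTop_nhds_zero.comp h1).congr fun t => ?_
    simp [Complex.norm_exp]
    ring
  simpa using this

theorem exists_complex_polynomial_near (a b : ℝ) (f : ℝ → ℂ) (hf : ContinuousOn f (Icc a b))
    (ε : ℝ) (hε : 0 < ε) :
    ∃ p : Polynomial ℂ, ∀ x ∈ Icc a b, ‖p.eval (x : ℂ) - f x‖ < ε := by
  obtain ⟨p, hp⟩ := exists_polynomial_near_of_continuousOn a b (fun x => (f x).re)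
    (Complex.continuous_re.comp_continuousOn hf) (ε / 2) (by positivity)
  obtain ⟨q, hq⟩ := exists_polynomial_near_of_continuousOn a b (fun x => (f x).im)
    (Complex.continuous_im.comp_continuousOn hf) (ε / 2) (by positivity)
  refine ⟨p.map Complex.ofRealHom + Polynomial.C Complex.I * q.map Complex.ofRealHom,
    fun x hx => ?_⟩
  have e : ∀ r : Polynomial ℝ, (r.map Complex.ofRealHom).eval (x : ℂ) = ((r.eval x : ℝ) : ℂ) := by
    intro r
    have := Polynomial.eval_map_apply (p := r) Complex.ofRealHom x
    simpa using this
  have h1 := hp x hx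
  have h2 := hq x hx
  have h3 : (p.map Complex.ofRealHom + Polynomial.C Complex.I * q.map Complex.ofRealHom).eval (x : ℂ)
      - f x = ((p.eval x - (f x).re : ℝ) : ℂ) + Complex.I * ((q.eval x - (f x).im : ℝ) : ℂ) := by
    simp only [Polynomial.eval_add, Polynomial.eval_mul, Polynomial.eval_C, e]
    conv_lhs => rw [← Complex.re_add_im (f x)]
    push_cast
    ring
  rw [h3]
  refine (norm_add_le _ _).trans_lt ?_
  rw [norm_mul, Complex.norm_I, one_mul, Complex.norm_real, Complex.norm_real]
  simp only [Real.norm_eq_abs]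
  linarith

/-- Exponential sums approximate, with the weight `exp (-t)`, a continuous function that vanishes
near infinity. -/
theorem exists_expSum_near (h : ℝ → ℂ) (hc : Continuous h) (T : ℝ) (hT : ∀ t, T < t → h t = 0)
    (A ε : ℝ) (hε : 0 < ε) :
    ∃ (N : ℕ) (a : ℕ → ℂ), ∀ t, A ≤ t → ‖expSum N a t - h t‖ ≤ ε * Real.exp (-t) := by
  -- Substitute x = e^{-t}. Dividing by x reserves a factor e^{-t}, which becomes the weight in the
  -- error bound.
  have hcont : ContinuousOn (fun x : ℝ => h (-Real.log x) / x) (Icc 0 (Real.exp (-A))) := by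
    intro x hx
    refine ContinuousAt.continuousWithinAt ?_
    rcases hx.1.eq_or_lt with h0 | h0
    · subst h0
      -- Since `Real.log x` is log |x|, the function vanishes on both sides of 0; at 0 itself
      -- division by zero gives 0.
      have : (fun x : ℝ => h (-Real.log x) / x) =ᶠ[𝓝 0] fun _ => 0 := by
        have : Ioo (-Real.exp (-T)) (Real.exp (-T)) ∈ 𝓝 (0 : ℝ) :=
          Ioo_mem_nhds (by simp [Real.exp_pos]) (Real.exp_pos _)
        filter_upwards [this] with x hx
        rcases eq_or_ne x 0 with h0 | h0
        · simp [h0]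
        · rw [hT, zero_div]
          have : |x| < Real.exp (-T) := abs_lt.2 hx
          have h2 := Real.log_lt_log (abs_pos.2 h0) this
          rw [Real.log_exp, Real.log_abs] at h2
          linarith
      exact (continuousAt_const (y := (0 : ℂ))).congr this.symm
    · refine ContinuousAt.div ?_ Complex.continuous_ofReal.continuousAt (by exact_mod_cast h0.ne')
      exact hc.continuousAt.comp (Real.continuousAt_log h0.ne').neg
  obtain ⟨p, hp⟩ := exists_complex_polynomial_near _ _ _ hcont ε hε
  -- Multiplying p(e^{-t}) by the reserved factor e^{-t} shifts the exponents from n to n + 1.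
  refine ⟨p.natDegree + 1, p.coeff, fun t ht => ?_⟩
  have h1 := hp (Real.exp (-t)) ⟨(Real.exp_pos _).le, Real.exp_le_exp.2 (by linarith)⟩
  have hx0 : ((Real.exp (-t) : ℝ) : ℂ) ≠ 0 := by exact_mod_cast (Real.exp_pos _).ne'
  have h2 : expSum (p.natDegree + 1) p.coeff t - h t
      = (p.eval ((Real.exp (-t) : ℝ) : ℂ) - h (-Real.log (Real.exp (-t))) / (Real.exp (-t) : ℝ))
        * (Real.exp (-t) : ℝ) := by
    rw [sub_mul, div_mul_cancel₀ _ hx0, Real.log_exp, neg_neg, Polynomial.eval_eq_sum_range,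
      Finset.sum_mul]
    congr 1
    refine Finset.sum_congr rfl fun n _ => ?_
    rw [mul_assoc, ← pow_succ]
    congr 1
    rw [Complex.ofReal_exp, ← Complex.exp_nat_mul]
    congr 1
    push_cast
    ring
  rw [h2, norm_mul, Complex.norm_real, Real.norm_of_nonneg (Real.exp_pos _).le]
  exact mul_le_mul_of_nonneg_right h1.le (Real.exp_pos _).le

/-- A function that vanishes at infinity inherits an exponential bound from its derivative. -/
theorem norm_le_exp_of_norm_deriv_le (u u' : ℝ → ℂ) (A ε : ℝ)
    (hu : ∀ t, HasDerivAt u (u' t) t) (h0 : Tendsto u atTop (𝓝 0))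
    (hb : ∀ t, A ≤ t → ‖u' t‖ ≤ ε * Real.exp (-t)) (t : ℝ) (ht : A ≤ t) :
    ‖u t‖ ≤ ε * Real.exp (-t) := by
  -- The bound on u' is the derivative of the boundary function ε(e^{-t} - e^{-x}); then b → ∞,
  -- where u(b) → 0.
  have key : ∀ b, t ≤ b → ‖u b - u t‖ ≤ ε * Real.exp (-t) - ε * Real.exp (-b) := by
    intro b hb'
    refine image_norm_le_of_norm_deriv_right_le_deriv_boundary (f := fun x => u x - u t)
      (f' := u') (a := t) (b := b) (B := fun x => ε * Real.exp (-t) - ε * Real.exp (-x))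
      (B' := fun x => ε * Real.exp (-x)) ?_ ?_ ?_ ?_ ?_ ⟨hb', le_rfl⟩
    · exact fun x _ => ((hu x).sub_const _).continuousAt.continuousWithinAt
    · exact fun x _ => ((hu x).sub_const _).hasDerivWithinAt
    · simp
    · intro x
      have := (((hasDerivAt_neg x).exp).const_mul ε).const_sub (ε * Real.exp (-t))
      exact this.congr_deriv (by ring)
    · exact fun x hx => hb x (ht.trans hx.1)
  have l1 : Tendsto (fun b => ‖u b - u t‖) atTop (𝓝 ‖0 - u t‖) := (h0.sub_const _).norm
  have l2 : Tendsto (fun b => ε * Real.exp (-t) - ε * Real.exp (-b)) atTop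
      (𝓝 (ε * Real.exp (-t) - ε * 0)) :=
    (Real.tendsto_exp_neg_atTop_nhds_zero.const_mul ε).const_sub _
  have := le_of_tendsto_of_tendsto l1 l2 ((eventually_ge_atTop t).mono key)
  simpa using this

/-- Exponential sums approximate a smooth function that vanishes near infinity together with its
derivatives up to a given order. -/
theorem exists_expSum_iteratedDeriv_near (ψ : ℝ → ℂ) (hψ : ContDiff ℝ ((⊤ : ℕ∞) : WithTop ℕ∞) ψ)
    (T : ℝ) (hT : ∀ t, T < t → ψ t = 0) (A ε : ℝ) (hε : 0 < ε) (m : ℕ) :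
    ∃ (N : ℕ) (a : ℕ → ℂ), ∀ j ≤ m, ∀ t, A ≤ t →
      ‖iteratedDeriv j (fun t => expSum N a t - ψ t) t‖ ≤ ε * Real.exp (-t) := by
  have hz : ∀ j t, T < t → iteratedDeriv j ψ t = 0 := by
    intro j t ht
    have : ψ =ᶠ[𝓝 t] fun _ => 0 := by
      filter_upwards [Ioi_mem_nhds ht] with x hx using hT x hx
    rw [this.iteratedDeriv_eq j]
    simp
  obtain ⟨N, b, hb⟩ := exists_expSum_near (iteratedDeriv m ψ)
    (hψ.continuous_iteratedDeriv m (by exact_mod_cast le_top)) T (hz m) A ε hε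
  -- The top derivative is approximated first. Dividing each coefficient by (-(n+1))^m takes the
  -- m-fold antiderivative that decays at infinity.
  set a : ℕ → ℂ := fun n => b n / (-((n : ℂ) + 1)) ^ m with ha
  have hsub : ∀ j, iteratedDeriv j (fun t => expSum N a t - ψ t)
      = fun t => iteratedDeriv j (expSum N a) t - iteratedDeriv j ψ t := by
    intro j
    ext t
    exact iteratedDeriv_sub ((contDiff_expSum N a).contDiffAt.of_le (by exact_mod_cast le_top))
      (hψ.contDiffAt.of_le (by exact_mod_cast le_top))
  refine ⟨N, a, fun j hj => ?_⟩
  -- Descend from order m: the error of order j vanishes at infinity, so it inherits the bound from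
  -- order j + 1.
  induction hj using Nat.decreasingInduction with
  | self =>
    intro t ht
    rw [hsub, iteratedDeriv_expSum]
    refine le_of_eq_of_le (congrArg (fun c => ‖expSum N c t - iteratedDeriv m ψ t‖) ?_) (hb t ht)
    ext n
    have : (-((n : ℂ) + 1)) ≠ 0 := by
      rw [neg_ne_zero]; exact_mod_cast n.succ_ne_zero
    exact div_mul_cancel₀ _ (pow_ne_zero m this)
  | of_succ j hj ih =>
    have hcd : ContDiff ℝ ((⊤ : ℕ∞) : WithTop ℕ∞) (fun t => expSum N a t - ψ t) :=
      (contDiff_expSum N a).sub hψ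
    refine norm_le_exp_of_norm_deriv_le _
      (iteratedDeriv (j + 1) (fun t => expSum N a t - ψ t)) A ε ?_ ?_ ih
    · intro t
      rw [iteratedDeriv_succ]
      exact (hcd.differentiable_iteratedDeriv j (by exact_mod_cast ENat.natCast_lt_top j) t).hasDerivAt
    · rw [hsub, iteratedDeriv_expSum]
      have := (tendsto_expSum N (fun n => a n * (-((n : ℂ) + 1)) ^ j))
      refine this.congr' ?_
      filter_upwards [eventually_gt_atTop T] with t ht
      rw [hz j t ht, sub_zero]

/-! ### Cutoffs and Schwartz seminorms -/

/-- A smooth cutoff, `0` on `(-∞, -2]` and `1` on `[-1, ∞)`. -/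
noncomputable def cutoff (t : ℝ) : ℂ := (Real.smoothTransition (t + 2) : ℂ)

theorem cutoff_of_le {t : ℝ} (ht : t ≤ -2) : cutoff t = 0 := by
  simp [cutoff, Real.smoothTransition.zero_of_nonpos (by linarith : t + 2 ≤ 0)]

theorem cutoff_of_ge {t : ℝ} (ht : -1 ≤ t) : cutoff t = 1 := by
  simp [cutoff, Real.smoothTransition.one_of_one_le (by linarith : 1 ≤ t + 2)]

theorem contDiff_cutoff : ContDiff ℝ ((⊤ : ℕ∞) : WithTop ℕ∞) cutoff :=
  Complex.ofRealCLM.contDiff.comp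
    (Real.smoothTransition.contDiff.comp (contDiff_id.add contDiff_const))

theorem iteratedDeriv_cutoff_of_lt {t : ℝ} (ht : t < -2) (j : ℕ) : iteratedDeriv j cutoff t = 0 := by
  have : cutoff =ᶠ[𝓝 t] fun _ => 0 := by
    filter_upwards [Iio_mem_nhds ht] with x hx using cutoff_of_le (le_of_lt hx)
  rw [this.iteratedDeriv_eq j]
  simp

theorem iteratedDeriv_cutoff_of_gt {t : ℝ} (ht : -1 < t) (j : ℕ) :
    iteratedDeriv j cutoff t = if j = 0 then 1 else 0 := by
  have : cutoff =ᶠ[𝓝 t] fun _ => 1 := by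
    filter_upwards [Ioi_mem_nhds ht] with x hx using cutoff_of_ge (le_of_lt hx)
  rw [this.iteratedDeriv_eq j, iteratedDeriv_const]

theorem exists_bound_iteratedDeriv_cutoff (j : ℕ) :
    ∃ B : ℝ, ∀ t, ‖iteratedDeriv j cutoff t‖ ≤ B := by
  obtain ⟨B, hB⟩ := (isCompact_Icc (a := (-2 : ℝ)) (b := -1)).exists_bound_of_continuousOn
    (contDiff_cutoff.continuous_iteratedDeriv j (by exact_mod_cast le_top)).continuousOn
  refine ⟨max B 1, fun t => ?_⟩
  rcases lt_or_ge t (-2) with h | h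
  · simp [iteratedDeriv_cutoff_of_lt h]
  rcases le_or_gt t (-1) with h' | h'
  · exact (hB t ⟨h, h'⟩).trans (le_max_left _ _)
  · rw [iteratedDeriv_cutoff_of_gt h']
    refine le_trans ?_ (le_max_right _ _)
    split_ifs <;> simp

theorem exists_bound_iteratedDeriv_cutoff_le (n : ℕ) :
    ∃ B : ℝ, 0 ≤ B ∧ ∀ j ≤ n, ∀ t, ‖iteratedDeriv j cutoff t‖ ≤ B := by
  choose B hB using exists_bound_iteratedDeriv_cutoff
  have hB0 : ∀ j, 0 ≤ B j := fun j => (norm_nonneg _).trans (hB j 0)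
  refine ⟨∑ j ∈ Finset.range (n + 1), B j, Finset.sum_nonneg fun j _ => hB0 j, fun j hj t => ?_⟩
  exact (hB j t).trans (Finset.single_le_sum (f := B) (fun i _ => hB0 i)
    (Finset.mem_range.2 (by omega)))

theorem norm_iteratedDeriv_mul_le_of_le {u v : ℝ → ℂ} (hu : ContDiff ℝ ((⊤ : ℕ∞) : WithTop ℕ∞) u)
    (hv : ContDiff ℝ ((⊤ : ℕ∞) : WithTop ℕ∞) v) (n : ℕ) (x U V : ℝ) (hU : 0 ≤ U)
    (hub : ∀ j ≤ n, ‖iteratedDeriv j u x‖ ≤ U) (hvb : ∀ j ≤ n, ‖iteratedDeriv j v x‖ ≤ V) :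
    ‖iteratedDeriv n (fun t => u t * v t) x‖ ≤ 2 ^ n * U * V := by
  have h := norm_iteratedFDeriv_mul_le hu hv x (n := n) (by exact_mod_cast le_top)
  simp only [norm_iteratedFDeriv_eq_norm_iteratedDeriv] at h
  refine h.trans ?_
  have : (2 : ℝ) ^ n * U * V = ∑ i ∈ Finset.range (n + 1), (n.choose i : ℝ) * U * V := by
    rw [← Finset.sum_mul, ← Finset.sum_mul]
    congr 2
    exact_mod_cast (Nat.sum_range_choose n).symm
  rw [this]
  refine Finset.sum_le_sum fun i hi => ?_
  have hi' := Finset.mem_range.1 hi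
  gcongr
  · exact hub i (by omega)
  · exact hvb (n - i) (by omega)

theorem exists_pow_mul_exp_neg_le (k : ℕ) : ∃ C : ℝ, 0 ≤ C ∧ ∀ t : ℝ, -2 ≤ t →
    |t| ^ k * Real.exp (-t) ≤ C := by
  -- The term 2^k e² covers [-2, 0]; the factor k! covers t > 0, by t^k / k! ≤ e^t.
  refine ⟨(2 ^ k + k.factorial) * Real.exp 2, by positivity, fun t ht => ?_⟩
  rcases le_or_gt t 0 with h | h
  · have h1 : |t| ≤ 2 := abs_le.2 ⟨ht, by linarith⟩
    have h2 : Real.exp (-t) ≤ Real.exp 2 := Real.exp_le_exp.2 (by linarith)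
    have h3 : |t| ^ k ≤ 2 ^ k := pow_le_pow_left₀ (abs_nonneg _) h1 k
    have h4 : (0 : ℝ) ≤ k.factorial := by positivity
    calc |t| ^ k * Real.exp (-t) ≤ 2 ^ k * Real.exp 2 := by gcongr
      _ ≤ _ := by gcongr; linarith
  · rw [abs_of_pos h, Real.exp_neg, ← div_eq_mul_inv, div_le_iff₀ (Real.exp_pos _)]
    have h1 := Real.pow_div_factorial_le_exp t h.le k
    rw [div_le_iff₀ (by positivity)] at h1
    have h2 : (1 : ℝ) ≤ Real.exp 2 := Real.one_le_exp (by norm_num)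
    have h3 : (k.factorial : ℝ) ≤ (2 ^ k + k.factorial) * Real.exp 2 := by
      have : (0 : ℝ) ≤ 2 ^ k := by positivity
      have : (0 : ℝ) ≤ k.factorial := by positivity
      nlinarith
    calc t ^ k ≤ Real.exp t * k.factorial := h1
      _ ≤ Real.exp t * ((2 ^ k + k.factorial) * Real.exp 2) := by gcongr
      _ = _ := by ring

/-- Multiplication by the cutoff turns exponentially decaying derivatives into Schwartz bounds. -/
theorem exists_bound_cutoff_mul (k n : ℕ) : ∃ C : ℝ, 0 ≤ C ∧ ∀ (v : ℝ → ℂ) (V : ℝ),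
    ContDiff ℝ ((⊤ : ℕ∞) : WithTop ℕ∞) v →
    (∀ j ≤ n, ∀ t, -2 ≤ t → ‖iteratedDeriv j v t‖ ≤ V * Real.exp (-t)) →
    ∀ x, |x| ^ k * ‖iteratedDeriv n (fun t => cutoff t * v t) x‖ ≤ C * V := by
  obtain ⟨B, hB0, hB⟩ := exists_bound_iteratedDeriv_cutoff_le n
  obtain ⟨C, hC0, hC⟩ := exists_pow_mul_exp_neg_le k
  refine ⟨2 ^ n * B * C, by positivity, fun v V hv hb x => ?_⟩
  have hV : 0 ≤ V := by
    have := (norm_nonneg _).trans (hb 0 (Nat.zero_le _) 0 (by norm_num))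
    simpa using this
  rcases lt_or_ge x (-2) with h | h
  · have := norm_iteratedDeriv_mul_le_of_le contDiff_cutoff hv n x 0
      (∑ j ∈ Finset.range (n + 1), ‖iteratedDeriv j v x‖) le_rfl
      (fun j _ => by simp [iteratedDeriv_cutoff_of_lt h]) (fun j hj =>
        Finset.single_le_sum (f := fun j => ‖iteratedDeriv j v x‖) (fun i _ => norm_nonneg _)
          (Finset.mem_range.2 (by omega)))
    have h0 : ‖iteratedDeriv n (fun t => cutoff t * v t) x‖ = 0 :=
      le_antisymm (by simpa using this) (norm_nonneg _)
    rw [h0, mul_zero]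
    positivity
  · have := norm_iteratedDeriv_mul_le_of_le contDiff_cutoff hv n x B (V * Real.exp (-x)) hB0
      (fun j hj => hB j hj x) (fun j hj => hb j hj x h)
    calc |x| ^ k * ‖iteratedDeriv n (fun t => cutoff t * v t) x‖
        ≤ |x| ^ k * (2 ^ n * B * (V * Real.exp (-x))) := by gcongr
      _ = 2 ^ n * B * V * (|x| ^ k * Real.exp (-x)) := by ring
      _ ≤ 2 ^ n * B * V * C := by gcongr; exact hC x h
      _ = _ := by ring

theorem norm_expSum_le (N : ℕ) (a : ℕ → ℂ) (t : ℝ) (ht : -2 ≤ t) :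
    ‖expSum N a t‖ ≤ (∑ n ∈ Finset.range N, ‖a n‖ * Real.exp (2 * n)) * Real.exp (-t) := by
  rw [Finset.sum_mul]
  refine (norm_sum_le _ _).trans (Finset.sum_le_sum fun n _ => ?_)
  rw [norm_mul, mul_assoc]
  refine mul_le_mul_of_nonneg_left ?_ (norm_nonneg _)
  rw [← Real.exp_add, Complex.norm_exp]
  refine Real.exp_le_exp.2 ?_
  have h1 : (-((n : ℂ) + 1) * (t : ℂ)).re = -((n : ℝ) + 1) * t := by simp
  rw [h1]
  have : (0 : ℝ) ≤ n := by positivity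
  nlinarith

/-- The product of the cutoff and an exponential sum, as a Schwartz function. -/
noncomputable def cutoffExpSum (N : ℕ) (a : ℕ → ℂ) : 𝓢(ℝ, ℂ) where
  toFun t := cutoff t * expSum N a t
  smooth' := contDiff_cutoff.mul (contDiff_expSum N a)
  decay' k n := by
    obtain ⟨C, _, hC⟩ := exists_bound_cutoff_mul k n
    refine ⟨C * ∑ j ∈ Finset.range (n + 1),
      ∑ i ∈ Finset.range N, ‖a i * (-((i : ℂ) + 1)) ^ j‖ * Real.exp (2 * i), fun x => ?_⟩
    rw [norm_iteratedFDeriv_eq_norm_iteratedDeriv]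
    refine hC _ _ (contDiff_expSum N a) (fun j hj t ht => ?_) x
    rw [iteratedDeriv_expSum]
    refine (norm_expSum_le N _ t ht).trans ?_
    refine mul_le_mul_of_nonneg_right ?_ (Real.exp_pos _).le
    exact Finset.single_le_sum (f := fun j => ∑ i ∈ Finset.range N,
      ‖a i * (-((i : ℂ) + 1)) ^ j‖ * Real.exp (2 * i)) (fun i _ => by positivity)
      (Finset.mem_range.2 (by omega))

theorem cutoffExpSum_apply (N : ℕ) (a : ℕ → ℂ) (t : ℝ) :
    cutoffExpSum N a t = cutoff t * expSum N a t := rfl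

theorem hasTemperateGrowth_of_bounded_iteratedDeriv {u : ℝ → ℂ}
    (hu : ContDiff ℝ ((⊤ : ℕ∞) : WithTop ℕ∞) u)
    (hb : ∀ j, ∃ B : ℝ, ∀ t, ‖iteratedDeriv j u t‖ ≤ B) : Function.HasTemperateGrowth u := by
  refine ⟨hu, fun n => ?_⟩
  obtain ⟨B, hB⟩ := hb n
  refine ⟨0, B, fun x => ?_⟩
  rw [norm_iteratedFDeriv_eq_norm_iteratedDeriv]
  simpa using hB x

theorem hasTemperateGrowth_cutoff : Function.HasTemperateGrowth cutoff :=
  hasTemperateGrowth_of_bounded_iteratedDeriv contDiff_cutoff exists_bound_iteratedDeriv_cutoff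

theorem norm_iteratedDeriv_cutoff_const_sub (c : ℝ) (j : ℕ) (t : ℝ) :
    ‖iteratedDeriv j (fun t => cutoff (c - t)) t‖ = ‖iteratedDeriv j cutoff (c - t)‖ := by
  rw [iteratedDeriv_comp_const_sub, norm_smul]
  simp

theorem contDiff_cutoff_const_sub (c : ℝ) :
    ContDiff ℝ ((⊤ : ℕ∞) : WithTop ℕ∞) (fun t => cutoff (c - t)) :=
  contDiff_cutoff.comp (contDiff_const.sub contDiff_id)

theorem hasTemperateGrowth_cutoff_const_sub (c : ℝ) :
    Function.HasTemperateGrowth (fun t => cutoff (c - t)) := by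
  refine hasTemperateGrowth_of_bounded_iteratedDeriv (contDiff_cutoff_const_sub c) fun j => ?_
  obtain ⟨B, hB⟩ := exists_bound_iteratedDeriv_cutoff j
  exact ⟨B, fun t => by rw [norm_iteratedDeriv_cutoff_const_sub]; exact hB _⟩

/-- The bounds are only needed eventually, separately for each seminorm: the approximants below
control derivatives up to an order that grows with the index. -/
theorem tendsto_of_forall_bound {u : ℕ → 𝓢(ℝ, ℂ)} {ψ : 𝓢(ℝ, ℂ)}
    (h : ∀ k n : ℕ, ∃ b : ℕ → ℝ, Tendsto b atTop (𝓝 0) ∧ ∀ᶠ i in atTop, ∀ x,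
      |x| ^ k * ‖iteratedDeriv n (fun t => u i t - ψ t) x‖ ≤ b i) :
    Tendsto u atTop (𝓝 ψ) := by
  rw [(schwartz_withSeminorms ℂ ℝ ℂ).tendsto_nhds]
  rintro ⟨k, n⟩ ε hε
  obtain ⟨b, hb, hub⟩ := h k n
  filter_upwards [hub, hb.eventually (gt_mem_nhds hε)] with i hi hbi
  refine lt_of_le_of_lt ?_ hbi
  refine SchwartzMap.seminorm_le_bound' ℂ k n _ ?_ hi
  exact le_trans (by positivity) (hi 0)

/-- Cutting a Schwartz function off on the right. -/
theorem tendsto_cutoff_const_sub (ψ : 𝓢(ℝ, ℂ)) :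
    Tendsto (fun i : ℕ => SchwartzMap.smulLeftCLM ℂ (fun t => cutoff (i - t)) ψ) atTop (𝓝 ψ) := by
  refine tendsto_of_forall_bound fun k n => ?_
  obtain ⟨B, hB0, hB⟩ := exists_bound_iteratedDeriv_cutoff_le n
  -- Seminorms of weight k + 1 leave one spare power of x. Where the cutoff is not yet known to be
  -- 1, x > i, and that power supplies the factor 1/i.
  set S : ℝ := ∑ j ∈ Finset.range (n + 1), SchwartzMap.seminorm ℂ (k + 1) j ψ with hS
  have hS0 : 0 ≤ S := Finset.sum_nonneg fun j _ => apply_nonneg _ _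
  refine ⟨fun i => 2 ^ n * (B + 1) * (S * (i : ℝ)⁻¹), ?_, ?_⟩
  · have := ((tendsto_natCast_atTop_atTop (R := ℝ)).inv_tendsto_atTop.const_mul S).const_mul
      (2 ^ n * (B + 1))
    simpa using this
  filter_upwards [eventually_gt_atTop 0] with i hi x
  have hi' : (0 : ℝ) < i := by exact_mod_cast hi
  have hfun : (fun t => SchwartzMap.smulLeftCLM ℂ (fun t => cutoff (i - t)) ψ t - ψ t)
      = fun t => (cutoff (i - t) - 1) * ψ t := by
    ext t
    rw [SchwartzMap.smulLeftCLM_apply_apply (hasTemperateGrowth_cutoff_const_sub _), smul_eq_mul]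
    ring
  rw [hfun]
  rcases le_or_gt x i with hx | hx
  · have : (fun t => (cutoff (i - t) - 1) * ψ t) =ᶠ[𝓝 x] fun _ => 0 := by
      filter_upwards [Iio_mem_nhds (by linarith : x < i + 1)] with t ht
      have : t < i + 1 := ht
      rw [cutoff_of_ge (by linarith), sub_self, zero_mul]
    rw [this.iteratedDeriv_eq n]
    simp only [iteratedDeriv_fun_const_zero, norm_zero, mul_zero]
    positivity
  · have hx0 : 0 < x := hi'.trans hx
    have hcd : ContDiff ℝ ((⊤ : ℕ∞) : WithTop ℕ∞) (fun t : ℝ => cutoff (i - t) - 1) :=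
      (contDiff_cutoff_const_sub i).sub contDiff_const
    have hbu : ∀ j ≤ n, ‖iteratedDeriv j (fun t : ℝ => cutoff (i - t) - 1) x‖ ≤ B + 1 := by
      intro j hj
      have : iteratedDeriv j (fun t : ℝ => cutoff (i - t) - 1) x
          = iteratedDeriv j (fun t : ℝ => cutoff (i - t)) x - iteratedDeriv j (fun _ : ℝ => (1 : ℂ)) x :=
        iteratedDeriv_sub ((contDiff_cutoff_const_sub i).contDiffAt.of_le (by exact_mod_cast le_top))
          contDiffAt_const
      rw [this]
      refine (norm_sub_le _ _).trans (add_le_add ?_ ?_)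
      · rw [norm_iteratedDeriv_cutoff_const_sub]
        exact hB j hj _
      · rw [iteratedDeriv_const]
        split_ifs <;> simp
    have hbv : ∀ j ≤ n, ‖iteratedDeriv j ψ x‖ ≤ S * (x ^ (k + 1))⁻¹ := by
      intro j hj
      have h1 := SchwartzMap.le_seminorm' ℂ (k + 1) j ψ x
      have h2 : SchwartzMap.seminorm ℂ (k + 1) j ψ ≤ S :=
        Finset.single_le_sum (f := fun j => SchwartzMap.seminorm ℂ (k + 1) j ψ)
          (fun j _ => apply_nonneg _ _) (Finset.mem_range.2 (by omega))
      rw [abs_of_pos hx0] at h1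
      rw [← div_eq_mul_inv, le_div_iff₀ (by positivity), mul_comm]
      exact h1.trans h2
    have := norm_iteratedDeriv_mul_le_of_le hcd (ψ.smooth ⊤) n x (B + 1) _ (by positivity) hbu hbv
    rw [abs_of_pos hx0]
    calc x ^ k * ‖iteratedDeriv n (fun t => (cutoff (i - t) - 1) * ψ t) x‖
        ≤ x ^ k * (2 ^ n * (B + 1) * (S * (x ^ (k + 1))⁻¹)) := by gcongr
      _ = 2 ^ n * (B + 1) * (S * x⁻¹) := by field_simp; ring
      _ ≤ 2 ^ n * (B + 1) * (S * (i : ℝ)⁻¹) := by gcongr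

/-! ### Uniqueness of the inverse Laplace transform -/

/-- A tempered distribution supported in `[0, ∞)` is determined by the values of its Laplace
transform at the positive integers. -/
theorem eq_zero_of_forall_laplace_eq_zero (d : 𝓢'(ℝ, ℂ)) (hd : Distribution.IsVanishingOn d (Iio 0))
    (h : ∀ (n : ℕ) (ψ : 𝓢(ℝ, ℂ)),
      (∀ t : ℝ, -1 < t → ψ t = Complex.exp (-((n : ℂ) + 1) * t)) → d ψ = 0) (ψ : 𝓢(ℝ, ℂ)) :
    d ψ = 0 := by
  have hE : ∀ N a, d (cutoffExpSum N a) = 0 := by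
    intro N a
    -- By linearity only single exponentials matter, and a cut-off exponential agrees with the
    -- exponential on (-1,∞).
    have hsum : cutoffExpSum N a = ∑ n ∈ Finset.range N,
        a n • cutoffExpSum (n + 1) (fun i => if i = n then 1 else 0) := by
      ext t
      rw [sum_apply, cutoffExpSum_apply, expSum, Finset.mul_sum]
      refine Finset.sum_congr rfl fun n _ => ?_
      rw [smul_apply, cutoffExpSum_apply, expSum]
      simp only [ite_mul, one_mul, zero_mul, Finset.sum_ite_eq', Finset.mem_range,
        Nat.lt_succ_self, if_true, smul_eq_mul]
      ring
    rw [hsum, map_sum]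
    refine Finset.sum_eq_zero fun n _ => ?_
    rw [map_smul, h n, smul_zero]
    intro t ht
    simp only [cutoffExpSum_apply, expSum, cutoff_of_ge ht.le, ite_mul, one_mul, zero_mul,
      Finset.sum_ite_eq', Finset.mem_range, Nat.lt_succ_self, if_true]
  have hright : ∀ (φ : 𝓢(ℝ, ℂ)) (T : ℝ), (∀ t, T < t → φ t = 0) → d φ = 0 := by
    intro φ T hT
    have hsplit : φ = SchwartzMap.smulLeftCLM ℂ cutoff φ
        + (φ - SchwartzMap.smulLeftCLM ℂ cutoff φ) := by abel
    have hcut : ∀ t, SchwartzMap.smulLeftCLM ℂ cutoff φ t = cutoff t * φ t := fun t => by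
      rw [SchwartzMap.smulLeftCLM_apply_apply hasTemperateGrowth_cutoff, smul_eq_mul]
    -- The cutoff is 1 on [-1,∞), so the discarded part is supported in (-∞,-1], where d vanishes.
    have hleft : d (φ - SchwartzMap.smulLeftCLM ℂ cutoff φ) = 0 := by
      refine hd _ ?_
      have : tsupport (φ - SchwartzMap.smulLeftCLM ℂ cutoff φ) ⊆ Iic (-1) := by
        refine closure_minimal (fun t ht => ?_) isClosed_Iic
        by_contra hlt
        refine ht ?_
        rw [mem_Iic, not_le] at hlt
        rw [sub_apply, hcut, cutoff_of_ge hlt.le, one_mul, sub_self]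
      exact this.trans (Iic_subset_Iio.2 (by norm_num))
    -- The index m serves both as accuracy 1/(m+1) and as the number of controlled derivatives, so
    -- every seminorm is eventually covered.
    choose N a hNa using fun m : ℕ => exists_expSum_iteratedDeriv_near φ (φ.smooth ⊤) T hT (-2)
      ((m : ℝ) + 1)⁻¹ (by positivity) m
    have hlim : Tendsto (fun m => cutoffExpSum (N m) (a m)) atTop
        (𝓝 (SchwartzMap.smulLeftCLM ℂ cutoff φ)) := by
      refine tendsto_of_forall_bound fun k n => ?_
      obtain ⟨C, hC0, hC⟩ := exists_bound_cutoff_mul k n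
      refine ⟨fun m => C * ((m : ℝ) + 1)⁻¹, ?_, ?_⟩
      · have := (tendsto_one_div_add_atTop_nhds_zero_nat (𝕜 := ℝ)).const_mul C
        simpa using this
      filter_upwards [eventually_ge_atTop n] with m hm x
      have hfun : (fun t => cutoffExpSum (N m) (a m) t - SchwartzMap.smulLeftCLM ℂ cutoff φ t)
          = fun t => cutoff t * (expSum (N m) (a m) t - φ t) := by
        ext t
        rw [hcut, mul_sub]
        rfl
      rw [hfun]
      exact hC _ _ ((contDiff_expSum _ _).sub (φ.smooth ⊤))
        (fun j hj t ht => hNa m j (hj.trans hm) t ht) x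
    have h1 : Tendsto (fun m => d (cutoffExpSum (N m) (a m))) atTop
        (𝓝 (d (SchwartzMap.smulLeftCLM ℂ cutoff φ))) :=
      (d.continuous.tendsto _).comp hlim
    simp only [hE] at h1
    rw [hsplit, map_add, hleft, add_zero]
    exact tendsto_nhds_unique h1 tendsto_const_nhds
  -- A general Schwartz function is the limit of its right truncations, which vanish beyond i + 2.
  have h1 : Tendsto (fun i : ℕ => d (SchwartzMap.smulLeftCLM ℂ (fun t => cutoff (i - t)) ψ)) atTop
      (𝓝 (d ψ)) := (d.continuous.tendsto _).comp (tendsto_cutoff_const_sub ψ)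
  have h2 : ∀ i : ℕ, d (SchwartzMap.smulLeftCLM ℂ (fun t => cutoff (i - t)) ψ) = 0 := by
    intro i
    refine hright _ (i + 2) fun t ht => ?_
    rw [SchwartzMap.smulLeftCLM_apply_apply (hasTemperateGrowth_cutoff_const_sub _),
      cutoff_of_le (by linarith), zero_smul]
  simp only [h2] at h1
  exact tendsto_nhds_unique h1 tendsto_const_nhds

theorem IsInverseLaplace.unique {p q : 𝓢'(ℝ, ℂ)} {F : ℂ → ℂ} (hp : IsInverseLaplace p F)
    (hq : IsInverseLaplace q F) : p = q := by
  ext ψ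
  rw [← sub_eq_zero]
  refine eq_zero_of_forall_laplace_eq_zero (p - q) ?_ ?_ ψ
  · intro u hu
    change p u - q u = 0
    rw [hp.1 u hu, hq.1 u hu, sub_self]
  · intro n u hu
    have hs : 0 < ((n : ℂ) + 1).re := by
      simp only [Complex.add_re, Complex.natCast_re, Complex.one_re]; positivity
    change p u - q u = 0
    rw [hp.2 _ hs u ⟨1, one_pos, hu⟩, hq.2 _ hs u ⟨1, one_pos, hu⟩, sub_self]

/-! ### Riemann–Liouville integrals and the semigroup law -/

/-- This is Euler's Beta integral after translating by u and scaling by t - u. -/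
theorem integral_rpow_mul_rpow {a b u t : ℝ} (ha : 0 < a) (hb : 0 < b) (hut : u < t) :
    ∫ r in u..t, (t - r) ^ (a - 1) * (r - u) ^ (b - 1)
      = (t - u) ^ (a + b - 1) * (Real.Gamma a * Real.Gamma b / Real.Gamma (a + b)) := by
  have hc : 0 < t - u := sub_pos.2 hut
  have h0 : ∫ r in u..t, (t - r) ^ (a - 1) * (r - u) ^ (b - 1)
      = ∫ x in (0 : ℝ)..(t - u), (t - u - x) ^ (a - 1) * x ^ (b - 1) := by
    have := intervalIntegral.integral_comp_sub_right (a := u) (b := t)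
      (fun x => (t - u - x) ^ (a - 1) * x ^ (b - 1)) u
    rw [sub_self] at this
    rw [← this]
    refine intervalIntegral.integral_congr fun r _ => ?_
    simp
  rw [h0]
  have h1 := Complex.betaIntegral_scaled (b : ℂ) (a : ℂ) hc
  have h2 := Complex.Gamma_mul_Gamma_eq_betaIntegral (s := (b : ℂ)) (t := (a : ℂ))
    (by simpa using hb) (by simpa using ha)
  have hG : Real.Gamma (a + b) ≠ 0 := (Real.Gamma_pos_of_pos (by positivity)).ne'
  have h3 : Complex.betaIntegral b a
      = ((Real.Gamma a * Real.Gamma b / Real.Gamma (a + b) : ℝ) : ℂ) := by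
    rw [← Complex.ofReal_add, Complex.Gamma_ofReal, Complex.Gamma_ofReal, Complex.Gamma_ofReal,
      add_comm b a] at h2
    push_cast
    rw [eq_div_iff (by exact_mod_cast hG), mul_comm, ← h2, mul_comm]
  have h4 : ∫ x in (0 : ℝ)..(t - u), (x : ℂ) ^ ((b : ℂ) - 1) * (((t - u : ℝ) : ℂ) - x) ^ ((a : ℂ) - 1)
      = ((∫ x in (0 : ℝ)..(t - u), (t - u - x) ^ (a - 1) * x ^ (b - 1) : ℝ) : ℂ) := by
    rw [← intervalIntegral.integral_ofReal]
    refine intervalIntegral.integral_congr fun x hx => ?_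
    rw [uIcc_of_le hc.le] at hx
    simp only [Complex.ofReal_mul]
    rw [Complex.ofReal_cpow hx.1, Complex.ofReal_cpow (sub_nonneg.2 hx.2)]
    push_cast
    ring
  rw [h4, h3] at h1
  have h5 : (((t - u : ℝ) : ℂ)) ^ ((b : ℂ) + a - 1) = (((t - u) ^ (a + b - 1) : ℝ) : ℂ) := by
    rw [Complex.ofReal_cpow hc.le]
    push_cast
    rw [add_comm (b : ℂ) a]
  rw [h5] at h1
  exact_mod_cast h1

theorem intervalIntegrable_rpow_mul_rpow {a b u t : ℝ} (ha : 0 < a) (hb : 0 < b) (hut : u < t) :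
    IntervalIntegrable (fun r => (t - r) ^ (a - 1) * (r - u) ^ (b - 1)) volume u t := by
  -- The integral of a non-integrable function is 0 by convention, so a positive value forces
  -- integrability.
  refine intervalIntegral.intervalIntegrable_of_integral_ne_zero ?_
  rw [integral_rpow_mul_rpow ha hb hut]
  have := Real.rpow_pos_of_pos (sub_pos.2 hut) (a + b - 1)
  have := Real.Gamma_pos_of_pos ha
  have := Real.Gamma_pos_of_pos hb
  have := Real.Gamma_pos_of_pos (add_pos ha hb)
  positivity

theorem intervalIntegrable_rpow_sub {a : ℝ} (ha : 0 < a) (t : ℝ) :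
    IntervalIntegrable (fun r : ℝ => (((t - r) ^ (a - 1) : ℝ) : ℂ)) volume 0 t := by
  have h := (intervalIntegral.intervalIntegrable_rpow' (a := 0) (b := t)
    (by linarith : -1 < a - 1)).comp_sub_left t
  rw [sub_zero, sub_self] at h
  exact ⟨h.symm.1.ofReal, h.symm.2.ofReal⟩

theorem intervalIntegrable_kernel_mul {a t : ℝ} (ha : 0 < a) (ht : 0 ≤ t) {y : ℝ → ℂ}
    (hy : ContinuousOn y (Ici 0)) :
    IntervalIntegrable (fun r : ℝ => (((t - r) ^ (a - 1) : ℝ) : ℂ) * y r) volume 0 t :=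
  (intervalIntegrable_rpow_sub ha t).mul_continuousOn
    (hy.mono (by rw [uIcc_of_le ht]; exact fun x hx => hx.1))

/-- For order at least 1 the kernel is continuous, so y only has to be integrable; this covers
derivatives y' and the densities g. -/
theorem intervalIntegrable_kernel_mul_of_one_le {a t : ℝ} (ha : 1 ≤ a) {y : ℝ → ℂ}
    (hy : IntervalIntegrable y volume 0 t) :
    IntervalIntegrable (fun r : ℝ => (((t - r) ^ (a - 1) : ℝ) : ℂ) * y r) volume 0 t := by
  refine hy.continuousOn_mul ?_
  refine Complex.continuous_ofReal.comp_continuousOn ?_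
  exact (continuousOn_const.sub continuousOn_id).rpow_const fun x _ => Or.inr (by linarith)

theorem rlIntegral_zero (a : ℝ) (y : ℝ → ℂ) : rlIntegral a y 0 = 0 := by
  simp [rlIntegral]

theorem rlIntegral_congr {a t : ℝ} (ht : 0 ≤ t) {y z : ℝ → ℂ} (h : EqOn y z (Icc 0 t)) :
    rlIntegral a y t = rlIntegral a z t := by
  unfold rlIntegral
  congr 1
  refine intervalIntegral.integral_congr fun r hr => ?_
  rw [uIcc_of_le ht] at hr
  simp only [h hr]

theorem rlIntegral_add {a t : ℝ} {y z : ℝ → ℂ}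
    (hy : IntervalIntegrable (fun r : ℝ => (((t - r) ^ (a - 1) : ℝ) : ℂ) * y r) volume 0 t)
    (hz : IntervalIntegrable (fun r : ℝ => (((t - r) ^ (a - 1) : ℝ) : ℂ) * z r) volume 0 t) :
    rlIntegral a (fun r => y r + z r) t = rlIntegral a y t + rlIntegral a z t := by
  unfold rlIntegral
  rw [← mul_add, ← intervalIntegral.integral_add hy hz]
  simp only [mul_add]

theorem rlIntegral_const_mul (a t : ℝ) (c : ℂ) (y : ℝ → ℂ) :
    rlIntegral a (fun r => c * y r) t = c * rlIntegral a y t := by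
  unfold rlIntegral
  rw [mul_left_comm, ← intervalIntegral.integral_const_mul c]
  congr 1
  refine intervalIntegral.integral_congr (f := fun r : ℝ => (((t - r) ^ (a - 1) : ℝ) : ℂ) * (c * y r))
    (g := fun r : ℝ => c * ((((t - r) ^ (a - 1) : ℝ) : ℂ) * y r)) fun r _ => ?_
  ring

theorem rlIntegral_one (y : ℝ → ℂ) (t : ℝ) : rlIntegral 1 y t = ∫ r in (0 : ℝ)..t, y r := by
  simp [rlIntegral]

/-- Setting r = tu fixes the interval and makes the singular kernel independent of t, so continuity
in t follows by dominated convergence. -/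
theorem rlIntegral_eq_scaled {a t : ℝ} (ht : 0 < t) (y : ℝ → ℂ) :
    rlIntegral a y t = (1 / (Real.Gamma a : ℂ)) * ((t ^ a : ℝ) : ℂ) *
      ∫ u in (0 : ℝ)..1, (((1 - u) ^ (a - 1) : ℝ) : ℂ) * y (t * u) := by
  have h := intervalIntegral.integral_comp_mul_left (a := 0) (b := 1)
    (fun r : ℝ => (((t - r) ^ (a - 1) : ℝ) : ℂ) * y r) ht.ne'
  rw [mul_zero, mul_one] at h
  have h2 : ∫ r in (0 : ℝ)..t, (((t - r) ^ (a - 1) : ℝ) : ℂ) * y r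
      = (t : ℂ) * ∫ u in (0 : ℝ)..1, (((t - t * u) ^ (a - 1) : ℝ) : ℂ) * y (t * u) := by
    rw [h, Complex.real_smul, ← mul_assoc, Complex.ofReal_inv,
      mul_inv_cancel₀ (by exact_mod_cast ht.ne'), one_mul]
  rw [rlIntegral, h2, mul_assoc, ← intervalIntegral.integral_const_mul (t : ℂ),
    ← intervalIntegral.integral_const_mul ((t ^ a : ℝ) : ℂ)]
  congr 1
  refine intervalIntegral.integral_congr
    (f := fun u : ℝ => (t : ℂ) * ((((t - t * u) ^ (a - 1) : ℝ) : ℂ) * y (t * u)))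
    (g := fun u : ℝ => ((t ^ a : ℝ) : ℂ) * ((((1 - u) ^ (a - 1) : ℝ) : ℂ) * y (t * u)))
    fun u hu => ?_
  rw [uIcc_of_le zero_le_one] at hu
  have e : t - t * u = t * (1 - u) := by ring
  simp only [e]
  rw [Real.mul_rpow ht.le (by linarith [hu.2]), ← mul_assoc, ← mul_assoc]
  congr 1
  norm_cast
  rw [← mul_assoc]
  congr 1
  rw [mul_comm t, ← Real.rpow_add_one ht.ne']
  congr 1
  ring

theorem continuousOn_rlIntegral {a : ℝ} (ha : 0 < a) {y : ℝ → ℂ} (hy : ContinuousOn y (Ici 0)) :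
    ContinuousOn (rlIntegral a y) (Ici 0) := by
  set z : ℝ → ℂ := fun r => y (max r 0) with hz
  have hzc : Continuous z := hy.comp_continuous (continuous_id.max continuous_const)
    fun r => mem_Ici.2 (le_max_right _ _)
  have hG : Continuous fun t : ℝ =>
      ∫ u in (0 : ℝ)..1, (((1 - u) ^ (a - 1) : ℝ) : ℂ) * z (t * u) := by
    rw [continuous_iff_continuousAt]
    intro t₀
    obtain ⟨M, hM⟩ := (isCompact_Icc (a := -(|t₀| + 1)) (b := |t₀| + 1)).exists_bound_of_continuousOn
      hzc.continuousOn
    refine intervalIntegral.continuousAt_of_dominated_interval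
      (bound := fun u => M * ‖(((1 - u) ^ (a - 1) : ℝ) : ℂ)‖) ?_ ?_ ?_ ?_
    · refine Eventually.of_forall fun t => ?_
      have h1 := (intervalIntegrable_rpow_sub ha 1).aestronglyMeasurable
      rw [uIoc_of_le zero_le_one]
      exact h1.mul (hzc.comp (continuous_const.mul continuous_id)).aestronglyMeasurable
    · have hnear : ∀ᶠ t in 𝓝 t₀, |t| < |t₀| + 1 :=
        continuous_abs.continuousAt.eventually (gt_mem_nhds (by linarith))
      filter_upwards [hnear] with t ht
      refine Eventually.of_forall fun u hu => ?_
      rw [uIoc_of_le zero_le_one] at hu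
      rw [norm_mul, mul_comm]
      refine mul_le_mul_of_nonneg_right (hM _ ?_) (norm_nonneg _)
      rw [mem_Icc, ← abs_le, abs_mul, abs_of_pos hu.1]
      nlinarith [abs_nonneg t, hu.2, hu.1]
    · exact (intervalIntegrable_rpow_sub ha 1).norm.const_mul M
    · refine Eventually.of_forall fun u _ => ?_
      exact (continuous_const.mul (hzc.comp (continuous_id.mul continuous_const))).continuousAt
  have hF : Continuous fun t : ℝ => (1 / (Real.Gamma a : ℂ)) * ((t ^ a : ℝ) : ℂ) *
      ∫ u in (0 : ℝ)..1, (((1 - u) ^ (a - 1) : ℝ) : ℂ) * z (t * u) := by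
    refine (continuous_const.mul (Complex.continuous_ofReal.comp ?_)).mul hG
    exact Real.continuous_rpow_const ha.le
  refine hF.continuousOn.congr fun t ht => ?_
  have ht' : 0 ≤ t := ht
  rcases ht'.eq_or_lt with h0 | h0
  · rw [← h0, rlIntegral_zero]
    simp [Real.zero_rpow ha.ne']
  · simp only
    rw [← rlIntegral_eq_scaled h0 z]
    refine rlIntegral_congr ht' fun r hr => ?_
    simp [hz, hr.1]

/-- The semigroup property `J^a J^b = J^(a+b)`. -/
theorem rlIntegral_rlIntegral {a b t : ℝ} (ha : 0 < a) (hb : 0 < b) (ht : 0 ≤ t) {y : ℝ → ℂ}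
    (hy : IntervalIntegrable y volume 0 t)
    (hyk : IntervalIntegrable (fun r : ℝ => (((t - r) ^ (a + b - 1) : ℝ) : ℂ) * y r) volume 0 t) :
    IntervalIntegrable (fun r : ℝ => (((t - r) ^ (a - 1) : ℝ) : ℂ) * rlIntegral b y r) volume 0 t ∧
    rlIntegral a (rlIntegral b y) t = rlIntegral (a + b) y t := by
  set M : Measure ℝ := volume.restrict (Ioc 0 t) with hM
  set K : ℝ × ℝ → ℝ := fun p => (t - p.1) ^ (a - 1) * (p.1 - p.2) ^ (b - 1) with hK
  set F : ℝ → ℝ → ℂ := fun r u => (Iio r).indicator (fun u => (K (r, u) : ℂ) * y u) u with hF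
  set β : ℝ := Real.Gamma a * Real.Gamma b / Real.Gamma (a + b) with hβ
  -- The integrand on the triangle u < r can be read as an indicator in either variable; this is
  -- what Fubini exchanges.
  have hF' : ∀ r u, F r u = (Ioi u).indicator (fun r => (K (r, u) : ℂ) * y u) r := by
    intro r u
    simp only [hF, indicator, mem_Iio, mem_Ioi]
  have hyM : AEStronglyMeasurable y M := hy.aestronglyMeasurable
  have hmeas : AEStronglyMeasurable (Function.uncurry F) (M.prod M) := by
    have h1 : Function.uncurry F = {p : ℝ × ℝ | p.2 < p.1}.indicator (fun p => (K p : ℂ) * y p.2) := by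
      ext ⟨r, u⟩
      simp only [Function.uncurry, hF, indicator, mem_Iio, mem_ofPred_eq]
    rw [h1]
    refine AEStronglyMeasurable.indicator ?_ (measurableSet_lt measurable_snd measurable_fst)
    refine AEStronglyMeasurable.mul ?_ hyM.comp_snd
    have : Measurable K := ((measurable_const.sub measurable_fst).pow_const _).mul
      ((measurable_fst.sub measurable_snd).pow_const _)
    exact (Complex.measurable_ofReal.comp this).aestronglyMeasurable
  have hIoc : ∀ u, 0 < u → Ioc 0 t ∩ Ioi u = Ioc u t := by
    intro u hu
    ext r
    simp only [mem_inter_iff, mem_Ioc, mem_Ioi]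
    constructor
    · rintro ⟨⟨_, h2⟩, h3⟩; exact ⟨h3, h2⟩
    · rintro ⟨h1, h2⟩; exact ⟨⟨hu.trans h1, h2⟩, h1⟩
  have hae : ∀ᵐ u ∂M, u ∈ Ioo 0 t := by
    rw [hM, ← restrict_Ioo_eq_restrict_Ioc]
    exact ae_restrict_mem measurableSet_Ioo
  have hKint : ∀ u ∈ Ioo 0 t, IntegrableOn (fun r => K (r, u)) (Ioc u t) := by
    intro u hu
    have := intervalIntegrable_rpow_mul_rpow ha hb hu.2
    rwa [intervalIntegrable_iff_integrableOn_Ioc_of_le hu.2.le] at this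
  have hslice : ∀ u ∈ Ioo 0 t, ∫ r, F r u ∂M = (((t - u) ^ (a + b - 1) : ℝ) : ℂ) * y u * β := by
    intro u hu
    simp only [hF']
    rw [hM, setIntegral_indicator measurableSet_Ioi, hIoc u hu.1, integral_mul_const,
      integral_complex_ofReal, ← intervalIntegral.integral_of_le hu.2.le,
      integral_rpow_mul_rpow ha hb hu.2, ← hβ]
    push_cast
    ring
  -- Tonelli: integrating the norm over r gives the Beta factor times |(t-u)^{a+b-1} y(u)|,
  -- integrable by `hyk`.
  have hint : Integrable (Function.uncurry F) (M.prod M) := by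
    rw [integrable_prod_iff' hmeas]
    constructor
    · filter_upwards [hae] with u hu
      simp only [Function.uncurry_apply_pair, hF']
      rw [integrable_indicator_iff measurableSet_Ioi, IntegrableOn, hM,
        Measure.restrict_restrict measurableSet_Ioi, inter_comm, hIoc u hu.1]
      exact (hKint u hu).ofReal.mul_const _
    · have h1 : Integrable (fun u => ‖(((t - u) ^ (a + b - 1) : ℝ) : ℂ) * y u‖ * β) M := by
        rw [intervalIntegrable_iff_integrableOn_Ioc_of_le ht] at hyk
        exact hyk.norm.mul_const _
      refine h1.congr ?_
      filter_upwards [hae] with u hu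
      simp only [Function.uncurry_apply_pair, hF', norm_indicator_eq_indicator_norm, norm_mul,
        Complex.norm_real]
      rw [hM, setIntegral_indicator measurableSet_Ioi, hIoc u hu.1, integral_mul_const]
      have h2 : ∫ r in Ioc u t, ‖K (r, u)‖ = ∫ r in Ioc u t, K (r, u) := by
        refine setIntegral_congr_fun measurableSet_Ioc fun r hr => ?_
        refine Real.norm_of_nonneg (mul_nonneg ?_ ?_)
        · exact Real.rpow_nonneg (by linarith [hr.2]) _
        · exact Real.rpow_nonneg (by linarith [hr.1]) _
      rw [h2, ← intervalIntegral.integral_of_le hu.2.le, integral_rpow_mul_rpow ha hb hu.2, ← hβ,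
        Real.norm_of_nonneg (Real.rpow_nonneg (by linarith [hu.2]) _)]
      ring
  have hrow : ∀ r ∈ Ioc 0 t, ∫ u, F r u ∂M
      = (Real.Gamma b : ℂ) * ((((t - r) ^ (a - 1) : ℝ) : ℂ) * rlIntegral b y r) := by
    intro r hr
    simp only [hF]
    have h1 : Ioc 0 t ∩ Iio r = Ioo 0 r := by
      ext u
      simp only [mem_inter_iff, mem_Ioc, mem_Iio, mem_Ioo]
      constructor
      · rintro ⟨⟨h1, _⟩, h3⟩; exact ⟨h1, h3⟩
      · rintro ⟨h1, h2⟩; exact ⟨⟨h1, h2.le.trans hr.2⟩, h2⟩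
    rw [hM, setIntegral_indicator measurableSet_Iio, h1, ← integral_Ioc_eq_integral_Ioo,
      ← intervalIntegral.integral_of_le hr.1.le, rlIntegral]
    have hG : (Real.Gamma b : ℂ) ≠ 0 := by exact_mod_cast (Real.Gamma_pos_of_pos hb).ne'
    have h2 : ∫ u in (0 : ℝ)..r, (K (r, u) : ℂ) * y u
        = (((t - r) ^ (a - 1) : ℝ) : ℂ) * ∫ u in (0 : ℝ)..r, (((r - u) ^ (b - 1) : ℝ) : ℂ) * y u := by
      rw [← intervalIntegral.integral_const_mul]
      refine intervalIntegral.integral_congr fun u _ => ?_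
      simp only [hK, Complex.ofReal_mul]
      ring
    rw [h2]
    field_simp
  have hGa : (Real.Gamma a : ℂ) ≠ 0 := by exact_mod_cast (Real.Gamma_pos_of_pos ha).ne'
  have hGb : (Real.Gamma b : ℂ) ≠ 0 := by exact_mod_cast (Real.Gamma_pos_of_pos hb).ne'
  have hGab : (Real.Gamma (a + b) : ℂ) ≠ 0 := by
    exact_mod_cast (Real.Gamma_pos_of_pos (add_pos ha hb)).ne'
  constructor
  · rw [intervalIntegrable_iff_integrableOn_Ioc_of_le ht]
    have h1 := hint.integral_prod_left.const_mul (Real.Gamma b : ℂ)⁻¹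
    refine h1.congr ?_
    rw [hM]
    filter_upwards [ae_restrict_mem measurableSet_Ioc] with r hr
    simp only [Function.uncurry_apply_pair]
    rw [hrow r hr, inv_mul_cancel_left₀ hGb]
  · have hswap := integral_integral_swap hint
    have hL : ∫ r, ∫ u, F r u ∂M ∂M
        = (Real.Gamma b : ℂ) * ∫ r in (0 : ℝ)..t, (((t - r) ^ (a - 1) : ℝ) : ℂ) * rlIntegral b y r := by
      rw [← intervalIntegral.integral_const_mul, intervalIntegral.integral_of_le ht]
      exact setIntegral_congr_fun measurableSet_Ioc hrow
    have hR : ∫ u, ∫ r, F r u ∂M ∂M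
        = (∫ u in (0 : ℝ)..t, (((t - u) ^ (a + b - 1) : ℝ) : ℂ) * y u) * β := by
      rw [← intervalIntegral.integral_mul_const, intervalIntegral.integral_of_le ht]
      refine integral_congr_ae ?_
      filter_upwards [hae] with u hu using hslice u hu
    rw [hL, hR, hβ] at hswap
    unfold rlIntegral at hswap ⊢
    push_cast at hswap
    field_simp at hswap ⊢
    linear_combination hswap

theorem rlIntegral_rlIntegral_of_continuousOn {a b t : ℝ} (ha : 0 < a) (hb : 0 < b) (ht : 0 ≤ t)
    {y : ℝ → ℂ} (hy : ContinuousOn y (Ici 0)) :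
    rlIntegral a (rlIntegral b y) t = rlIntegral (a + b) y t := by
  refine (rlIntegral_rlIntegral ha hb ht ?_ (intervalIntegrable_kernel_mul (add_pos ha hb) ht hy)).2
  exact (hy.mono (by rw [uIcc_of_le ht]; exact fun x hx => hx.1)).intervalIntegrable

/-! ### Caputo derivatives and the Volterra equation -/

theorem intervalIntegrable_of_continuousOn_Ici {t : ℝ} (ht : 0 ≤ t) {h : ℝ → ℂ}
    (hh : ContinuousOn h (Ici 0)) : IntervalIntegrable h volume 0 t :=
  (hh.mono (by rw [uIcc_of_le ht]; exact fun x hx => hx.1)).intervalIntegrable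

theorem hasDerivAt_integral_of_continuousOn_Ici {t : ℝ} (ht : 0 < t) {h : ℝ → ℂ}
    (hh : ContinuousOn h (Ici 0)) : HasDerivAt (fun t => ∫ r in (0 : ℝ)..t, h r) (h t) t := by
  refine intervalIntegral.integral_hasDerivAt_right
    (intervalIntegrable_of_continuousOn_Ici ht.le hh) ?_ (hh.continuousAt (Ici_mem_nhds ht))
  exact (hh.mono Ioi_subset_Ici_self).stronglyMeasurableAtFilter isOpen_Ioi t ht

/-- The derivative of `J^(1-α) z` is `h` exactly when `z = J^α h`. -/
theorem hasDerivAt_rlIntegral_iff {α : ℝ} (hα0 : 0 < α) (hα1 : α < 1) {z h : ℝ → ℂ}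
    (hz : ContinuousOn z (Ici 0)) (hh : ContinuousOn h (Ici 0)) (hz0 : z 0 = 0) :
    (∀ t, 0 < t → HasDerivAt (rlIntegral (1 - α) z) (h t) t) ↔
      ∀ t, 0 ≤ t → z t = rlIntegral α h t := by
  have h1α : 0 < 1 - α := sub_pos.2 hα1
  constructor
  · intro H
    -- Integrating the equation gives J^{1-α} z = J^1 h. Applying J^α gives J^1 z = J^1 J^α h, and
    -- differentiating removes J^1.
    have hJ : ∀ t, 0 ≤ t → rlIntegral (1 - α) z t = rlIntegral 1 h t := by
      intro t ht
      have := intervalIntegral.integral_eq_sub_of_hasDerivAt_of_le ht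
        ((continuousOn_rlIntegral h1α hz).mono fun x hx => hx.1) (fun x hx => H x hx.1)
        (intervalIntegrable_of_continuousOn_Ici ht hh)
      rw [rlIntegral_one, this, rlIntegral_zero, sub_zero]
    have hI : ∀ t, 0 ≤ t → ∫ r in (0 : ℝ)..t, z r = ∫ r in (0 : ℝ)..t, rlIntegral α h r := by
      intro t ht
      have e1 := rlIntegral_rlIntegral_of_continuousOn hα0 h1α ht hz
      have e2 := rlIntegral_rlIntegral_of_continuousOn hα0 one_pos ht hh
      have e3 := rlIntegral_rlIntegral_of_continuousOn one_pos hα0 ht hh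
      have e4 : rlIntegral α (rlIntegral (1 - α) z) t = rlIntegral α (rlIntegral 1 h) t :=
        rlIntegral_congr ht fun r hr => hJ r hr.1
      rw [show α + (1 - α) = 1 by ring] at e1
      rw [← rlIntegral_one, ← rlIntegral_one, ← e1, e4, e2, e3, add_comm]
    intro t ht
    rcases ht.eq_or_lt with h0 | h0
    · rw [← h0, hz0, rlIntegral_zero]
    have d1 := hasDerivAt_integral_of_continuousOn_Ici h0 hz
    have d2 := hasDerivAt_integral_of_continuousOn_Ici h0 (continuousOn_rlIntegral hα0 hh)
    refine d1.unique (d2.congr_of_eventuallyEq ?_)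
    filter_upwards [Ioi_mem_nhds h0] with s hs using hI s (le_of_lt hs)
  · intro H t ht
    refine (hasDerivAt_integral_of_continuousOn_Ici ht hh).congr_of_eventuallyEq ?_
    filter_upwards [Ioi_mem_nhds ht] with s hs
    have hs' : 0 ≤ s := le_of_lt hs
    rw [rlIntegral_congr hs' (z := rlIntegral α h) fun r hr => H r hr.1,
      rlIntegral_rlIntegral_of_continuousOn h1α hα0 hs' hh, sub_add_cancel, rlIntegral_one]

/-- Increments of g are dominated by those of f, so the same δ works; this passes absolute
continuity to real and imaginary parts. -/
theorem _root_.AbsolutelyContinuousOnInterval.of_dist_le {X Y : Type*} [PseudoMetricSpace X]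
    [PseudoMetricSpace Y] {f : ℝ → X} {g : ℝ → Y} {a b : ℝ}
    (hf : AbsolutelyContinuousOnInterval f a b) (h : ∀ s t, dist (g s) (g t) ≤ dist (f s) (f t)) :
    AbsolutelyContinuousOnInterval g a b := by
  rw [absolutelyContinuousOnInterval_iff] at hf ⊢
  intro ε hε
  obtain ⟨δ, hδ, H⟩ := hf ε hε
  exact ⟨δ, hδ, fun E hE hd => (Finset.sum_le_sum fun i _ => h _ _).trans_lt (H E hE hd)⟩

/-- The fundamental theorem of calculus for complex-valued absolutely continuous functions. -/
theorem _root_.AbsolutelyContinuousOnInterval.complex_integral_deriv {y : ℝ → ℂ} {a b : ℝ}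
    (hy : AbsolutelyContinuousOnInterval y a b) :
    IntervalIntegrable (deriv y) volume a b ∧ ∫ r in a..b, deriv y r = y b - y a := by
  have hre : AbsolutelyContinuousOnInterval (fun t => (y t).re) a b := by
    refine hy.of_dist_le fun s t => ?_
    rw [Real.dist_eq, Complex.dist_eq, ← Complex.sub_re]
    exact Complex.abs_re_le_norm _
  have him : AbsolutelyContinuousOnInterval (fun t => (y t).im) a b := by
    refine hy.of_dist_le fun s t => ?_
    rw [Real.dist_eq, Complex.dist_eq, ← Complex.sub_im]
    exact Complex.abs_im_le_norm _
  have hae : ∀ᵐ t : ℝ, t ∈ uIcc a b → deriv y t =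
      ((deriv (fun t => (y t).re) t : ℝ) : ℂ) + ((deriv (fun t => (y t).im) t : ℝ) : ℂ) * Complex.I := by
    filter_upwards [hre.ae_differentiableAt, him.ae_differentiableAt] with t h1 h2 ht
    have d := ((h1 ht).hasDerivAt.ofReal_comp).add (((h2 ht).hasDerivAt.ofReal_comp).mul_const Complex.I)
    refine HasDerivAt.deriv (d.congr_of_eventuallyEq (Eventually.of_forall fun s => ?_))
    exact (Complex.re_add_im (y s)).symm
  have i1 := hre.intervalIntegrable_deriv
  have i2 := him.intervalIntegrable_deriv
  have j1 : IntervalIntegrable (fun t => ((deriv (fun t => (y t).re) t : ℝ) : ℂ)) volume a b :=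
    ⟨i1.1.ofReal, i1.2.ofReal⟩
  have j2 : IntervalIntegrable (fun t => ((deriv (fun t => (y t).im) t : ℝ) : ℂ) * Complex.I)
      volume a b := IntervalIntegrable.mul_const ⟨i2.1.ofReal, i2.2.ofReal⟩ _
  have hae' : ∀ᵐ t : ℝ, t ∈ uIoc a b → ((deriv (fun t => (y t).re) t : ℝ) : ℂ)
      + ((deriv (fun t => (y t).im) t : ℝ) : ℂ) * Complex.I = deriv y t := by
    filter_upwards [hae] with t h ht using (h (uIoc_subset_uIcc ht)).symm
  refine ⟨(j1.add j2).congr_ae ((ae_restrict_iff' measurableSet_uIoc).2 hae'), ?_⟩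
  rw [← intervalIntegral.integral_congr_ae hae', intervalIntegral.integral_add j1 j2,
    intervalIntegral.integral_mul_const, intervalIntegral.integral_ofReal,
    intervalIntegral.integral_ofReal, hre.integral_deriv_eq_sub, him.integral_deriv_eq_sub]
  push_cast
  conv_rhs => rw [← Complex.re_add_im (y b), ← Complex.re_add_im (y a)]
  ring

/-- For a locally absolutely continuous function, `J^(1-α) (y - y 0)` is the primitive of the
Caputo derivative. -/
theorem LocallyAC.integral_caputoDeriv {α : ℝ} (hα1 : α < 1) {y : ℝ → ℂ}
    (hy : LocallyAC y) {t : ℝ} (ht : 0 < t) :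
    IntervalIntegrable (caputoDeriv α y) volume 0 t ∧
      rlIntegral (1 - α) (fun r => y r - y 0) t = ∫ r in (0 : ℝ)..t, caputoDeriv α y r := by
  have h1α : 0 < 1 - α := sub_pos.2 hα1
  have hi := (hy t ht).complex_integral_deriv.1
  have e : ∀ r ∈ Icc 0 t, y r - y 0 = rlIntegral 1 (deriv y) r := by
    intro r hr
    rcases hr.1.eq_or_lt with h0 | h0
    · rw [← h0, rlIntegral_zero, sub_self]
    · rw [rlIntegral_one, (hy r h0).complex_integral_deriv.2]
  -- Both orders of composing J^{1-α} and J^1 on y' give J^{2-α} y'; one is J^{1-α}(y - y(0)), the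
  -- other the primitive of the Caputo derivative.
  have s1 := rlIntegral_rlIntegral h1α one_pos ht.le hi
    (intervalIntegrable_kernel_mul_of_one_le (by linarith) hi)
  have s2 := rlIntegral_rlIntegral one_pos h1α ht.le hi
    (intervalIntegrable_kernel_mul_of_one_le (by linarith) hi)
  have hc : rlIntegral (1 - α) (deriv y) = caputoDeriv α y := rfl
  constructor
  · have := s2.1
    simpa [hc] using this
  · rw [rlIntegral_congr ht.le e, s1.2, add_comm, ← s2.2, rlIntegral_one, hc]

/-! ### Comparison of solution notions and uniqueness -/

section Solutions

variable {α τ : ℝ} {lam : ℂ} {φ f y : ℝ → ℂ}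

theorem HasHistory.continuousOn_rhs (hf : ContinuousOn f (Ici 0))
    (hy : HasHistory τ φ y) : ContinuousOn (fun t => lam * y (t - τ) + f t) (Ici 0) := by
  refine (continuousOn_const.mul (hy.1.comp (continuousOn_id.sub continuousOn_const) ?_)).add hf
  intro t ht
  have : (0 : ℝ) ≤ t := ht
  simpa using this

theorem HasHistory.continuousOn_sub (hτ : 0 < τ) (hy : HasHistory τ φ y) :
    ContinuousOn (fun t => y t - y 0) (Ici 0) :=
  (hy.1.mono (Ici_subset_Ici.2 (by linarith))).sub continuousOn_const

theorem HasHistory.isContinuousSolution_iff (hα0 : 0 < α) (hα1 : α < 1) (hτ : 0 < τ)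
    (hf : ContinuousOn f (Ici 0)) (hy : HasHistory τ φ y) :
    IsContinuousSolution α τ lam φ f y ↔
      ∀ t, 0 ≤ t → y t - y 0 = rlIntegral α (fun t => lam * y (t - τ) + f t) t := by
  rw [IsContinuousSolution, and_iff_right hy]
  exact hasDerivAt_rlIntegral_iff hα0 hα1 (hy.continuousOn_sub hτ) (hy.continuousOn_rhs hf)
    (sub_self _)

/-- J^{1-α}(y - y(0)) is the primitive of a function equal a.e. to the continuous right-hand side,
so its derivative exists at every t > 0. -/
theorem IsCaputoSolution.isContinuousSolution (hα1 : α < 1) (hf : ContinuousOn f (Ici 0)) (hy : IsCaputoSolution α τ lam φ f y) :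
    IsContinuousSolution α τ lam φ f y := by
  obtain ⟨hh, hac, hae⟩ := hy
  refine ⟨hh, fun t ht => ?_⟩
  refine (hasDerivAt_integral_of_continuousOn_Ici ht
    (hh.continuousOn_rhs hf)).congr_of_eventuallyEq ?_
  filter_upwards [Ioi_mem_nhds ht] with s hs
  have hs' : 0 < s := hs
  rw [(hac.integral_caputoDeriv hα1 hs').2]
  refine intervalIntegral.integral_congr_ae ?_
  rw [ae_restrict_iff' measurableSet_Ioi] at hae
  filter_upwards [hae] with r hr hrs
  rw [uIoc_of_le hs'.le] at hrs
  exact hr hrs.1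

/-- By Lebesgue differentiation the primitive of the Caputo derivative has that derivative a.e.;
uniqueness of derivatives identifies it with the right-hand side. -/
theorem IsContinuousSolution.isCaputoSolution (hα1 : α < 1)
    (hy : IsContinuousSolution α τ lam φ f y) (hac : LocallyAC y) :
    IsCaputoSolution α τ lam φ f y := by
  refine ⟨hy.1, hac, ?_⟩
  rw [ae_restrict_iff' measurableSet_Ioi]
  -- Countably many intervals [0, n+1] exhaust the half-line, so the exceptional sets remain null.
  have h1 : ∀ n : ℕ, ∀ᵐ t : ℝ, t ∈ uIcc 0 ((n : ℝ) + 1) → ∀ c ∈ uIcc 0 ((n : ℝ) + 1),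
      HasDerivAt (fun x => ∫ r in c..x, caputoDeriv α y r) (caputoDeriv α y t) t := fun n =>
    (hac.integral_caputoDeriv hα1 (by positivity : (0 : ℝ) < n + 1)).1.ae_hasDerivAt_integral
  filter_upwards [ae_all_iff.2 h1] with t ht ht0
  have ht0' : 0 < t := ht0
  obtain ⟨n, hn⟩ := exists_nat_gt t
  have hn' : (0 : ℝ) ≤ (n : ℝ) + 1 := by positivity
  have d := ht n (by rw [uIcc_of_le hn']; exact ⟨ht0'.le, by linarith⟩) 0 left_mem_uIcc
  refine d.unique ((hy.2 t ht0').congr_of_eventuallyEq ?_)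
  filter_upwards [Ioi_mem_nhds ht0'] with s hs
  exact (hac.integral_caputoDeriv hα1 hs).2.symm

theorem IsContinuousSolution.unique (hα0 : 0 < α) (hα1 : α < 1) (hτ : 0 < τ)
    (hf : ContinuousOn f (Ici 0)) {x : ℝ → ℂ} (hx : IsContinuousSolution α τ lam φ f x)
    (hy : IsContinuousSolution α τ lam φ f y) : EqOn x y (Ici (-τ)) := by
  have hx' := (hx.1.isContinuousSolution_iff hα0 hα1 hτ hf).1 hx
  have hy' := (hy.1.isContinuousSolution_iff hα0 hα1 hτ hf).1 hy
  have h0 : EqOn x y (Icc (-τ) 0) := hx.1.2.trans hy.1.2.symm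
  -- Method of steps: for t ≤ (n+1)τ the Volterra integral only involves values at r - τ ≤ nτ.
  have key : ∀ n : ℕ, EqOn x y (Icc (-τ) (n * τ)) := by
    intro n
    induction n with
    | zero => simpa using h0
    | succ n ih =>
      intro t ht
      rcases le_or_gt t 0 with h | h
      · exact h0 ⟨ht.1, h⟩
      have e0 : x 0 = y 0 := h0 ⟨by linarith, le_rfl⟩
      have e1 : x t - x 0 = y t - y 0 := by
        rw [hx' t h.le, hy' t h.le]
        refine rlIntegral_congr h.le fun r hr => ?_
        have ht2 := ht.2
        push_cast at ht2
        rw [ih ⟨by linarith [hr.1], by linarith [hr.2]⟩]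
      rw [e0] at e1
      exact sub_left_inj.1 e1
  intro t ht
  obtain ⟨n, hn⟩ := exists_nat_gt (t / τ)
  exact key n ⟨ht, ((div_lt_iff₀ hτ).1 hn).le⟩

end Solutions

/-! ### The series solution -/

/-- `J^a w`, extended by zero to the negative half-line. -/
noncomputable def rlExt (a : ℝ) (w : ℝ → ℂ) (x : ℝ) : ℂ := rlIntegral a w (max x 0)

theorem rlExt_of_nonneg {a x : ℝ} (hx : 0 ≤ x) (w : ℝ → ℂ) : rlExt a w x = rlIntegral a w x := by
  rw [rlExt, max_eq_left hx]

theorem rlExt_of_nonpos {a x : ℝ} (hx : x ≤ 0) (w : ℝ → ℂ) : rlExt a w x = 0 := by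
  rw [rlExt, max_eq_right hx, rlIntegral_zero]

theorem continuous_rlExt {a : ℝ} (ha : 0 < a) {w : ℝ → ℂ} (hw : ContinuousOn w (Ici 0)) :
    Continuous (rlExt a w) :=
  (continuousOn_rlIntegral ha hw).comp_continuous (continuous_id.max continuous_const)
    fun _ => mem_Ici.2 (le_max_right _ _)

/-- Riemann--Liouville integrals commute with delays. -/
theorem rlIntegral_comp_sub {a c t : ℝ} (ha : 0 < a) (hc : 0 ≤ c) (ht : 0 ≤ t) {g : ℝ → ℂ}
    (hg : Continuous g) (hg0 : ∀ x ≤ 0, g x = 0) :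
    rlIntegral a (fun r => g (r - c)) t = rlExt a g (t - c) := by
  rcases le_or_gt t c with h | h
  · rw [rlExt_of_nonpos (by linarith)]
    rw [rlIntegral_congr ht (z := fun _ => 0) fun r hr => hg0 _ (by linarith [hr.2])]
    simp [rlIntegral]
  rw [rlExt_of_nonneg (by linarith)]
  unfold rlIntegral
  congr 1
  have hi : ∀ u v, u ∈ Icc 0 t → v ∈ Icc 0 t → IntervalIntegrable
      (fun r : ℝ => (((t - r) ^ (a - 1) : ℝ) : ℂ) * g (r - c)) volume u v := by
    intro u v hu hv
    refine (intervalIntegrable_kernel_mul ha ht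
      (hg.comp (continuous_id.sub continuous_const)).continuousOn).mono_set ?_
    rw [uIcc_of_le ht]
    exact uIcc_subset_Icc hu hv
  rw [← intervalIntegral.integral_add_adjacent_intervals (hi 0 c ⟨le_rfl, ht⟩ ⟨hc, h.le⟩)
    (hi c t ⟨hc, h.le⟩ ⟨ht, le_rfl⟩)]
  have z : ∫ r in (0 : ℝ)..c, (((t - r) ^ (a - 1) : ℝ) : ℂ) * g (r - c) = 0 := by
    rw [intervalIntegral.integral_congr (g := fun _ => 0), intervalIntegral.integral_zero]
    intro r hr
    rw [uIcc_of_le hc] at hr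
    simp [hg0 (r - c) (by linarith [hr.2])]
  rw [z, zero_add]
  have := intervalIntegral.integral_comp_sub_right (a := c) (b := t)
    (fun r : ℝ => (((t - c - r) ^ (a - 1) : ℝ) : ℂ) * g r) c
  rw [sub_self] at this
  rw [← this]
  refine intervalIntegral.integral_congr fun r _ => ?_
  simp

theorem rlIntegral_sum {ι : Type*} (s : Finset ι) {a t : ℝ} (ha : 0 < a) (ht : 0 ≤ t)
    {g : ι → ℝ → ℂ} (hg : ∀ i ∈ s, ContinuousOn (g i) (Ici 0)) :
    rlIntegral a (fun r => ∑ i ∈ s, g i r) t = ∑ i ∈ s, rlIntegral a (g i) t := by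
  unfold rlIntegral
  rw [← Finset.mul_sum, ← intervalIntegral.integral_finsetSum
    fun i hi => intervalIntegrable_kernel_mul ha ht (hg i hi)]
  simp only [Finset.mul_sum]

/-- The partial sum `∑ k < N, lam^k J^((k+1)α) w (t - k τ)`. -/
noncomputable def delaySum (α τ : ℝ) (lam : ℂ) (w : ℝ → ℂ) (N : ℕ) (t : ℝ) : ℂ :=
  ∑ k ∈ Finset.range N, lam ^ k * rlExt ((k + 1) * α) w (t - k * τ)

section DelaySum

variable {α τ : ℝ} {lam : ℂ} {w : ℝ → ℂ}

theorem continuous_delaySum (hα : 0 < α) (hw : ContinuousOn w (Ici 0)) (N : ℕ) :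
    Continuous (delaySum α τ lam w N) := by
  unfold delaySum
  refine continuous_finsetSum _ fun k _ => continuous_const.mul ?_
  exact (continuous_rlExt (by positivity) hw).comp (continuous_id.sub continuous_const)

theorem delaySum_of_nonpos (hτ : 0 ≤ τ) {t : ℝ} (ht : t ≤ 0) (N : ℕ) :
    delaySum α τ lam w N t = 0 := by
  refine Finset.sum_eq_zero fun k _ => ?_
  have : 0 ≤ (k : ℝ) * τ := by positivity
  rw [rlExt_of_nonpos (by linarith), mul_zero]

/-- The terms with kτ ≥ t vanish, so the floor in the formula can be replaced by any large enough N,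
kept fixed near a given point. -/
theorem delaySum_eq_of_le (hτ : 0 ≤ τ) {t : ℝ} {M N : ℕ} (hMN : M ≤ N) (ht : t ≤ M * τ) :
    delaySum α τ lam w N t = delaySum α τ lam w M t := by
  refine (Finset.sum_subset (Finset.range_mono hMN) fun k _ hk => ?_).symm
  have hk' : (M : ℝ) ≤ k := by exact_mod_cast not_lt.1 (fun h => hk (Finset.mem_range.2 h))
  have : (M : ℝ) * τ ≤ k * τ := by gcongr
  rw [rlExt_of_nonpos (by linarith), mul_zero]

/-- The summand w produces the term k = 0. Delaying and applying λ J^α turns term k into term k + 1,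
because J^α J^{(k+1)α} = J^{(k+2)α}. -/
theorem rlIntegral_add_delaySum (hα : 0 < α) (hτ : 0 ≤ τ) (hw : ContinuousOn w (Ici 0)) (N : ℕ)
    {t : ℝ} (ht : 0 ≤ t) :
    rlIntegral α (fun r => w r + lam * delaySum α τ lam w N (r - τ)) t
      = delaySum α τ lam w (N + 1) t := by
  have hsum : ∀ r, lam * delaySum α τ lam w N (r - τ) = ∑ k ∈ Finset.range N,
      lam ^ (k + 1) * rlExt ((k + 1) * α) w (r - (k + 1) * τ) := by
    intro r
    rw [delaySum, Finset.mul_sum]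
    refine Finset.sum_congr rfl fun k _ => ?_
    rw [show r - τ - k * τ = r - (k + 1) * τ by ring]
    ring
  have hc : ∀ k : ℕ, Continuous fun r => rlExt ((k + 1) * α) w (r - (k + 1) * τ) := fun k =>
    (continuous_rlExt (by positivity) hw).comp (continuous_id.sub continuous_const)
  have hcd : ContinuousOn (fun r => lam * delaySum α τ lam w N (r - τ)) (Ici 0) :=
    (continuous_const.mul ((continuous_delaySum hα hw N).comp
      (continuous_id.sub continuous_const))).continuousOn
  rw [rlIntegral_add (intervalIntegrable_kernel_mul hα ht hw)
    (intervalIntegrable_kernel_mul hα ht hcd)]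
  simp only [hsum]
  rw [rlIntegral_sum (g := fun (k : ℕ) r => lam ^ (k + 1) * rlExt ((k + 1) * α) w (r - (k + 1) * τ))
    _ hα ht fun k _ => (continuous_const.mul (hc k)).continuousOn, delaySum,
    Finset.sum_range_succ', add_comm]
  congr 1
  · refine Finset.sum_congr rfl fun k _ => ?_
    have hk : 0 < ((k : ℝ) + 1) * α := by positivity
    rw [rlIntegral_const_mul, rlIntegral_comp_sub hα (by positivity) ht (continuous_rlExt hk hw)
      fun x hx => rlExt_of_nonpos hx w]
    congr 1
    push_cast
    rcases le_or_gt (t - (k + 1) * τ) 0 with h | h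
    · rw [rlExt_of_nonpos h, rlExt_of_nonpos h]
    · rw [rlExt_of_nonneg h.le, rlExt_of_nonneg h.le,
        rlIntegral_congr h.le (z := rlIntegral ((k + 1) * α) w) fun r hr => rlExt_of_nonneg hr.1 w,
        rlIntegral_rlIntegral_of_continuousOn hα hk h.le hw]
      congr 1
      ring
  · simp [rlExt_of_nonneg ht]

variable {φ f : ℝ → ℂ}

/-- The delayed history, continued by the constant `φ 0` to `[τ, ∞)`. -/
def shiftedHistory (τ : ℝ) (φ : ℝ → ℂ) (r : ℝ) : ℂ := φ (min (r - τ) 0)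

theorem continuousOn_shiftedHistory (hτ : 0 ≤ τ) (hφ : ContinuousOn φ (Icc (-τ) 0)) :
    ContinuousOn (shiftedHistory τ φ) (Ici 0) := by
  refine hφ.comp ((continuous_id.sub continuous_const).min continuous_const).continuousOn ?_
  intro r hr
  have hr' : (0 : ℝ) ≤ r := hr
  exact ⟨le_min (by linarith) (by linarith), min_le_right _ _⟩

/-- The solution of the fractional delay equation. -/
noncomputable def delaySolution (α τ : ℝ) (lam : ℂ) (φ f : ℝ → ℂ) (t : ℝ) : ℂ :=
  φ (min t 0)
    + delaySum α τ lam (fun r => lam * shiftedHistory τ φ r + f r) (⌊t / τ⌋₊ + 1) t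

theorem delaySolution_eq (hτ : 0 < τ) {t : ℝ} {N : ℕ} (ht : t ≤ N * τ) :
    delaySolution α τ lam φ f t = φ (min t 0)
      + delaySum α τ lam (fun r => lam * shiftedHistory τ φ r + f r) N t := by
  rw [delaySolution]
  congr 1
  have h1 : t ≤ ((⌊t / τ⌋₊ + 1 : ℕ) : ℝ) * τ := by
    have := Nat.lt_floor_add_one (t / τ)
    rw [div_lt_iff₀ hτ] at this
    push_cast
    exact this.le
  rcases le_total N (⌊t / τ⌋₊ + 1) with h | h
  · exact delaySum_eq_of_le hτ.le h ht
  · exact (delaySum_eq_of_le hτ.le h h1).symm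

theorem hasHistory_delaySolution (hα : 0 < α) (hτ : 0 < τ) (hφ : ContinuousOn φ (Icc (-τ) 0))
    (hf : ContinuousOn f (Ici 0)) : HasHistory τ φ (delaySolution α τ lam φ f) := by
  have hw : ContinuousOn (fun r => lam * shiftedHistory τ φ r + f r) (Ici 0) :=
    (continuousOn_const.mul (continuousOn_shiftedHistory hτ.le hφ)).add hf
  constructor
  · have h1 : ContinuousOn (fun t => φ (min t 0)) (Ici (-τ)) := by
      refine hφ.comp (continuous_id.min continuous_const).continuousOn fun t ht => ?_
      exact ⟨le_min ht (by linarith), min_le_right _ _⟩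
    intro t ht
    obtain ⟨N, hN⟩ := exists_nat_gt (t / τ)
    rw [div_lt_iff₀ hτ] at hN
    have h2 := (h1.add (continuous_delaySum (τ := τ) (lam := lam) hα hw N).continuousOn) t ht
    refine h2.congr_of_eventuallyEq ?_ (delaySolution_eq hτ hN.le)
    filter_upwards [mem_nhdsWithin_of_mem_nhds (Iio_mem_nhds hN)] with s hs
    exact delaySolution_eq hτ (le_of_lt hs)
  · intro t ht
    rw [delaySolution, delaySum_of_nonpos hτ.le ht.2, min_eq_left ht.2, add_zero]

theorem isContinuousSolution_delaySolution (hα0 : 0 < α) (hα1 : α < 1) (hτ : 0 < τ)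
    (hφ : ContinuousOn φ (Icc (-τ) 0)) (hf : ContinuousOn f (Ici 0)) :
    IsContinuousSolution α τ lam φ f (delaySolution α τ lam φ f) := by
  have hh := hasHistory_delaySolution (lam := lam) hα0 hτ hφ hf
  have hw : ContinuousOn (fun r => lam * shiftedHistory τ φ r + f r) (Ici 0) :=
    (continuousOn_const.mul (continuousOn_shiftedHistory hτ.le hφ)).add hf
  rw [hh.isContinuousSolution_iff hα0 hα1 hτ hf]
  intro t ht
  obtain ⟨N, hN⟩ := exists_nat_gt (t / τ)
  rw [div_lt_iff₀ hτ] at hN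
  -- At the delayed time the history part φ(min(r - τ, 0)) is Ψ(r), which joins f to form w.
  have e : EqOn (fun r => lam * delaySolution α τ lam φ f (r - τ) + f r)
      (fun r => lam * shiftedHistory τ φ r + f r + lam *
        delaySum α τ lam (fun r => lam * shiftedHistory τ φ r + f r) N (r - τ)) (Icc 0 t) := by
    intro r hr
    simp only
    rw [delaySolution_eq hτ (N := N) (by linarith [hr.2]), shiftedHistory]
    ring
  rw [rlIntegral_congr ht e, rlIntegral_add_delaySum hα0 hτ.le hw N ht,
    delaySolution_eq hτ (N := N + 1) (by push_cast; linarith), hh.2 ⟨by linarith, le_rfl⟩,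
    min_eq_right ht]
  ring

/-- Linearity of J^{(k+1)α} on w = λΨ + f separates the history from the forcing; the extra λ gives
the power k + 1. -/
theorem delaySolution_formula (hα : 0 < α) (hτ : 0 < τ) (hφ : ContinuousOn φ (Icc (-τ) 0))
    (hf : ContinuousOn f (Ici 0)) {t : ℝ} (ht : 0 ≤ t) :
    delaySolution α τ lam φ f t = φ 0
      + ∑ k ∈ Finset.range (⌊t / τ⌋₊ + 1),
          lam ^ (k + 1) * rlIntegral ((k + 1) * α) (shiftedHistory τ φ) (t - k * τ)
      + genIntegral α τ lam f t := by
  rw [delaySolution, min_eq_right ht, add_assoc, genIntegral, ← Finset.sum_add_distrib, delaySum]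
  congr 1
  refine Finset.sum_congr rfl fun k hk => ?_
  have hk' : (k : ℝ) ≤ t / τ :=
    (Nat.le_floor_iff (by positivity)).1 (Nat.lt_succ_iff.1 (Finset.mem_range.1 hk))
  rw [le_div_iff₀ hτ] at hk'
  have hx : 0 ≤ t - k * τ := sub_nonneg.2 hk'
  have ha : 0 < ((k : ℝ) + 1) * α := by positivity
  rw [rlExt_of_nonneg hx, rlIntegral_add (y := fun r => lam * shiftedHistory τ φ r) (intervalIntegrable_kernel_mul ha hx
    (continuousOn_const.mul (continuousOn_shiftedHistory hτ.le hφ)))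
    (intervalIntegrable_kernel_mul ha hx hf), rlIntegral_const_mul, rlIntegral.eq_def _ f,
    show ((k : ℝ) + 1) * α = α * k + α by ring]
  ring

end DelaySum

/-! ### The inverse Laplace transform as a distributional derivative -/

/-- The distributional derivative of a bounded function on the half-line, extended by zero. -/
theorem exists_distribution_deriv (Ψ : ℝ → ℂ) (hΨ : ContinuousOn Ψ (Ici 0)) (C : ℝ)
    (hC : ∀ r, 0 ≤ r → ‖Ψ r‖ ≤ C) :
    ∃ p : 𝓢'(ℝ, ℂ), ∀ ψ : 𝓢(ℝ, ℂ), p ψ = -∫ r in Ioi (0 : ℝ), deriv ψ r * Ψ r := by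
  have hm : MemLp ((Ioi (0 : ℝ)).indicator Ψ) ⊤ volume := by
    refine memLp_top_of_bound ?_ C (Eventually.of_forall fun r => ?_)
    · exact (aestronglyMeasurable_indicator_iff measurableSet_Ioi).2
        ((hΨ.mono Ioi_subset_Ici_self).aestronglyMeasurable measurableSet_Ioi)
    · by_cases hr : r ∈ Ioi (0 : ℝ)
      · rw [indicator_of_mem hr]
        exact hC r (le_of_lt hr)
      · rw [indicator_of_notMem hr, norm_zero]
        exact (norm_nonneg _).trans (hC 0 le_rfl)
  refine ⟨TemperedDistribution.derivCLM ℂ (Lp.toTemperedDistribution hm.toLp), fun ψ => ?_⟩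
  rw [TemperedDistribution.derivCLM_apply_apply, map_neg, Lp.toTemperedDistribution_apply,
    ← integral_indicator measurableSet_Ioi]
  congr 1
  refine integral_congr_ae ?_
  filter_upwards [hm.coeFn_toLp] with r hr
  rw [hr, SchwartzMap.derivCLM_apply, smul_eq_mul, indicator_mul_right]

theorem integrableOn_exp_mul_of_bound {Ψ : ℝ → ℂ} (hΨ : ContinuousOn Ψ (Ici 0)) {C : ℝ}
    (hC : ∀ r, 0 ≤ r → ‖Ψ r‖ ≤ C) {s : ℂ} (hs : 0 < s.re) :
    IntegrableOn (fun r : ℝ => Complex.exp (-s * r) * Ψ r) (Ioi 0) := by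
  have h1 : IntegrableOn (fun r : ℝ => Complex.exp (-s * r)) (Ioi 0) :=
    integrableOn_exp_mul_complex_Ioi (by simpa using hs) 0
  refine Integrable.mul_bdd (c := C) h1
    ((hΨ.mono Ioi_subset_Ici_self).aestronglyMeasurable measurableSet_Ioi) ?_
  filter_upwards [ae_restrict_mem measurableSet_Ioi] with r hr using hC r (le_of_lt hr)

theorem exists_bound_shiftedHistory {τ : ℝ} (hτ : 0 ≤ τ) {φ : ℝ → ℂ}
    (hφ : ContinuousOn φ (Icc (-τ) 0)) : ∃ C, ∀ r, 0 ≤ r → ‖shiftedHistory τ φ r‖ ≤ C := by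
  obtain ⟨C, hC⟩ := isCompact_Icc.exists_bound_of_continuousOn hφ
  exact ⟨C, fun r hr => hC _ ⟨le_min (by linarith) (by linarith), min_le_right _ _⟩⟩

/-- On (0,τ] a shift yields e^{-sτ} times the history integral; on (τ,∞) the constant φ(0)
contributes e^{-sτ} φ(0)/s. -/
theorem laplace_shiftedHistory {τ : ℝ} (hτ : 0 < τ) {φ : ℝ → ℂ}
    (hφ : ContinuousOn φ (Icc (-τ) 0)) {s : ℂ} (hs : 0 < s.re) :
    s * ∫ r in Ioi (0 : ℝ), Complex.exp (-s * r) * shiftedHistory τ φ r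
      = historyTransform τ φ s := by
  obtain ⟨C, hC⟩ := exists_bound_shiftedHistory hτ.le hφ
  have hi := integrableOn_exp_mul_of_bound (continuousOn_shiftedHistory hτ.le hφ) hC hs
  have hs0 : s ≠ 0 := by
    rintro rfl
    simp at hs
  rw [← Ioc_union_Ioi_eq_Ioi hτ.le, setIntegral_union Ioc_disjoint_Ioi_same measurableSet_Ioi
    (hi.mono_set Ioc_subset_Ioi_self) (hi.mono_set (Ioi_subset_Ioi hτ.le))]
  have h1 : ∫ r in Ioc 0 τ, Complex.exp (-s * r) * shiftedHistory τ φ r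
      = Complex.exp (-s * τ) * ∫ r in (-τ)..(0 : ℝ), Complex.exp (-s * r) * φ r := by
    rw [← intervalIntegral.integral_of_le hτ.le]
    have := intervalIntegral.integral_comp_sub_right (a := 0) (b := τ)
      (fun r : ℝ => Complex.exp (-s * τ) * (Complex.exp (-s * r) * φ r)) τ
    rw [zero_sub, sub_self] at this
    rw [← intervalIntegral.integral_const_mul, ← this]
    refine intervalIntegral.integral_congr fun r hr => ?_
    rw [uIcc_of_le hτ.le] at hr
    simp only [shiftedHistory]
    rw [min_eq_left (by linarith [hr.2]), ← mul_assoc, ← Complex.exp_add]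
    congr 2
    push_cast
    ring
  have h2 : ∫ r in Ioi τ, Complex.exp (-s * r) * shiftedHistory τ φ r
      = Complex.exp (-s * τ) / s * φ 0 := by
    have : ∫ r in Ioi τ, Complex.exp (-s * r) * shiftedHistory τ φ r
        = ∫ r in Ioi τ, Complex.exp (-s * r) * φ 0 := by
      refine setIntegral_congr_fun measurableSet_Ioi fun r hr => ?_
      have hr' : τ < r := hr
      simp only [shiftedHistory]
      rw [min_eq_right (by linarith)]
    rw [this, integral_mul_const, integral_exp_mul_complex_Ioi (by simpa using hs)]
    rw [neg_div_neg_eq]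
  rw [h1, h2, historyTransform]
  field_simp
  ring

/-- On (0,∞) a representative ψ of e^{-s·} has derivative -s e^{-s·}, so the pairing becomes s times
the Laplace transform of Ψ. -/
theorem isInverseLaplace_of_shiftedHistory {τ : ℝ} (hτ : 0 < τ) {φ : ℝ → ℂ}
    (hφ : ContinuousOn φ (Icc (-τ) 0)) {p : 𝓢'(ℝ, ℂ)}
    (hp : ∀ ψ : 𝓢(ℝ, ℂ), p ψ = -∫ r in Ioi (0 : ℝ), deriv ψ r * shiftedHistory τ φ r) :
    IsInverseLaplace p (historyTransform τ φ) := by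
  constructor
  · intro ψ hψ
    rw [hp, setIntegral_congr_fun (g := fun _ => 0) measurableSet_Ioi, integral_zero, neg_zero]
    intro r hr
    have : deriv ψ r = 0 := by
      by_contra h
      exact lt_asymm (mem_Iio.1 (hψ (support_deriv_subset h))) (mem_Ioi.1 hr)
    simp [this]
  · rintro s hs ψ ⟨ε, hε, hψ⟩
    rw [hp, ← laplace_shiftedHistory hτ hφ hs, ← integral_const_mul, ← integral_neg]
    refine setIntegral_congr_fun measurableSet_Ioi fun r hr => ?_
    have hr' : 0 < r := hr
    have h1 : HasDerivAt (fun t : ℝ => Complex.exp (-s * t)) (Complex.exp (-s * r) * -s) r := by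
      have : HasDerivAt (fun t : ℝ => -s * (t : ℂ)) (-s) r := by
        simpa using (Complex.ofRealCLM.hasDerivAt (x := r)).const_mul (-s)
      exact this.cexp
    have h2 : deriv ψ r = Complex.exp (-s * r) * -s := by
      refine (h1.congr_of_eventuallyEq ?_).deriv
      filter_upwards [Ioi_mem_nhds (show -ε < r by linarith)] with t ht using hψ t ht
    simp only [h2]
    ring

/-! ### Convolution with truncated powers -/

/-- Symmetry of the Riemann--Liouville integral under the convolution pairing. -/
theorem integral_mul_rlIntegral_comm {β R : ℝ} (hβ : 0 < β) (hR : 0 ≤ R) {u v : ℝ → ℂ}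
    (hu : ContinuousOn u (Ici 0)) (hv : Continuous v) :
    ∫ r in (0 : ℝ)..R, u r * rlIntegral β (fun s => v (R - s)) (R - r)
      = ∫ x in (0 : ℝ)..R, rlIntegral β u x * v x := by
  -- Truncating kernel and functions to (0,R] makes the double integral that of an integrable
  -- convolution times a bounded function, so Fubini applies.
  set k : ℝ → ℂ := (Ioc 0 R).indicator fun x => ((x ^ (β - 1) : ℝ) : ℂ) with hk
  set g : ℝ → ℂ := (Ioc 0 R).indicator u with hg
  set w : ℝ → ℂ := (Ioc 0 R).indicator v with hw
  set F : ℝ → ℝ → ℂ := fun x r => w x * (g r * k (x - r)) with hF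
  have hki : Integrable k := by
    rw [hk, integrable_indicator_iff measurableSet_Ioc,
      ← intervalIntegrable_iff_integrableOn_Ioc_of_le hR]
    have := intervalIntegral.intervalIntegrable_rpow' (a := 0) (b := R) (by linarith : -1 < β - 1)
    exact ⟨this.1.ofReal, this.2.ofReal⟩
  have hgi : Integrable g := by
    rw [hg, integrable_indicator_iff measurableSet_Ioc,
      ← intervalIntegrable_iff_integrableOn_Ioc_of_le hR]
    exact intervalIntegrable_of_continuousOn_Ici hR hu
  obtain ⟨C, hC⟩ := (isCompact_Icc (a := (0 : ℝ)) (b := R)).exists_bound_of_continuousOn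
    hv.continuousOn
  have hint : Integrable (Function.uncurry F) (volume.prod volume) := by
    have h1 := hgi.convolution_integrand (ContinuousLinearMap.mul ℝ ℂ) hki
    have hwm : Measurable w := hv.measurable.indicator measurableSet_Ioc
    refine Integrable.bdd_mul (c := max C 0) h1
      (hwm.comp measurable_fst).aestronglyMeasurable (Eventually.of_forall fun p => ?_)
    simp only [hw]
    by_cases hx : p.1 ∈ Ioc 0 R
    · rw [indicator_of_mem hx]
      exact (hC _ (Ioc_subset_Icc_self hx)).trans (le_max_left _ _)
    · rw [indicator_of_notMem hx, norm_zero]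
      exact le_max_right _ _
  have hG : (Real.Gamma β : ℂ) ≠ 0 := by exact_mod_cast (Real.Gamma_pos_of_pos hβ).ne'
  have hx : ∀ x, ∫ r, F x r = (Ioc 0 R).indicator
      (fun x => (Real.Gamma β : ℂ) * (rlIntegral β u x * v x)) x := by
    intro x
    simp only [hF]
    rw [integral_const_mul]
    by_cases hx : x ∈ Ioc 0 R
    · rw [indicator_of_mem hx]
      have e : ∀ r, g r * k (x - r)
          = (Ioo 0 x).indicator (fun r => (((x - r) ^ (β - 1) : ℝ) : ℂ) * u r) r := by
        intro r
        by_cases hr : r ∈ Ioo 0 x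
        · rw [indicator_of_mem hr, hg, hk, indicator_of_mem (mem_Ioc.2 ⟨hr.1, hr.2.le.trans hx.2⟩),
            indicator_of_mem (mem_Ioc.2 ⟨sub_pos.2 hr.2, by linarith [hr.1, hx.2]⟩), mul_comm]
        · rw [indicator_of_notMem hr]
          by_cases h1 : r ∈ Ioc 0 R
          · have : x - r ∉ Ioc 0 R := fun h => hr ⟨h1.1, sub_pos.1 h.1⟩
            rw [hk, indicator_of_notMem this, mul_zero]
          · rw [hg, indicator_of_notMem h1, zero_mul]
      simp only [e]
      rw [integral_indicator measurableSet_Ioo, ← integral_Ioc_eq_integral_Ioo,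
        ← intervalIntegral.integral_of_le hx.1.le, rlIntegral, hw, indicator_of_mem hx]
      field_simp
    · rw [indicator_of_notMem hx, hw, indicator_of_notMem hx, zero_mul]
  have hr : ∀ r, ∫ x, F x r = (Ioc 0 R).indicator
      (fun r => (Real.Gamma β : ℂ) * (u r * rlIntegral β (fun s => v (R - s)) (R - r))) r := by
    intro r
    have e0 : ∀ x, F x r = g r * (w x * k (x - r)) := fun x => by simp only [hF]; ring
    simp only [e0]
    rw [integral_const_mul]
    by_cases hr : r ∈ Ioc 0 R
    · rw [indicator_of_mem hr]
      have e : ∀ x, w x * k (x - r)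
          = (Ioc r R).indicator (fun x => (((x - r) ^ (β - 1) : ℝ) : ℂ) * v x) x := by
        intro x
        by_cases hx : x ∈ Ioc r R
        · rw [indicator_of_mem hx, hw, hk, indicator_of_mem (mem_Ioc.2 ⟨hr.1.trans hx.1, hx.2⟩),
            indicator_of_mem (mem_Ioc.2 ⟨sub_pos.2 hx.1, by linarith [hr.1, hx.2]⟩), mul_comm]
        · rw [indicator_of_notMem hx]
          by_cases h1 : x ∈ Ioc 0 R
          · have : x - r ∉ Ioc 0 R := fun h => hx ⟨sub_pos.1 h.1, h1.2⟩
            rw [hk, indicator_of_notMem this, mul_zero]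
          · rw [hw, indicator_of_notMem h1, zero_mul]
      simp only [e]
      rw [integral_indicator measurableSet_Ioc, ← intervalIntegral.integral_of_le hr.2, rlIntegral,
        hg, indicator_of_mem hr]
      have h3 := intervalIntegral.integral_comp_sub_left (a := 0) (b := R - r)
        (fun x : ℝ => (((x - r) ^ (β - 1) : ℝ) : ℂ) * v x) R
      rw [sub_sub_cancel, sub_zero] at h3
      rw [← h3]
      have h4 : ∀ s : ℝ, R - s - r = R - r - s := fun s => by ring
      simp only [h4]
      field_simp
    · rw [indicator_of_notMem hr, hg, indicator_of_notMem hr, zero_mul]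
  have hswap := integral_integral_swap hint
  simp only [hx, hr] at hswap
  rw [integral_indicator measurableSet_Ioc, integral_indicator measurableSet_Ioc,
    integral_const_mul, integral_const_mul, ← intervalIntegral.integral_of_le hR,
    ← intervalIntegral.integral_of_le hR] at hswap
  exact (mul_left_cancel₀ hG hswap).symm

/-- The convolution of the distributional derivative of `Ψ` with a truncated power. -/
theorem isPowerConvolution_rlExt {Ψ : ℝ → ℂ} (hΨ : ContinuousOn Ψ (Ici 0)) {p : 𝓢'(ℝ, ℂ)}
    (hp : ∀ ψ : 𝓢(ℝ, ℂ), p ψ = -∫ r in Ioi (0 : ℝ), deriv ψ r * Ψ r) {β : ℝ} (hβ : 0 < β) :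
    IsPowerConvolution p β (fun x => (Real.Gamma (β + 1) : ℂ) * rlExt β Ψ x) := by
  refine ⟨continuous_const.mul (continuous_rlExt hβ hΨ), ?_⟩
  rintro ψ Θ hψ ⟨ε, hε, hΘ⟩
  obtain ⟨R, hR0, hR⟩ : ∃ R : ℝ, 0 < R ∧ ∀ x, R ≤ x → ψ x = 0 := by
    obtain ⟨R, hR⟩ := hψ.isCompact.bddAbove
    refine ⟨max R 0 + 1, by positivity, fun x hx => image_eq_zero_of_notMem_tsupport fun h => ?_⟩
    have := hR h
    have := le_max_left R 0
    linarith
  set v : ℝ → ℂ := fun s => ψ (R - s) with hv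
  have hvc : Continuous v := ψ.continuous.comp (continuous_const.sub continuous_id)
  have hG : (Real.Gamma (β + 1) : ℂ) ≠ 0 := by
    exact_mod_cast (Real.Gamma_pos_of_pos (by linarith)).ne'
  -- After reflection x = R - s, with R beyond the support of ψ, the integral defining Θ is Γ(β+1)
  -- J^{β+1} v (R - r). Written as a primitive of J^β v, it can be differentiated in r.
  have hΘ1 : ∀ r, -ε < r → r ≤ R → Θ r
      = (Real.Gamma (β + 1) : ℂ) * ∫ s in (0 : ℝ)..(R - r), rlIntegral β v s := by
    intro r hr hrR
    have hrR' : 0 ≤ R - r := sub_nonneg.2 hrR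
    rw [← rlIntegral_one, rlIntegral_rlIntegral_of_continuousOn one_pos hβ hrR' hvc.continuousOn,
      add_comm 1 β, rlIntegral, hΘ r hr, ← mul_assoc, mul_one_div_cancel hG, one_mul,
      add_sub_cancel_right]
    have h3 := intervalIntegral.integral_comp_sub_left (a := 0) (b := R - r)
      (fun x : ℝ => (((x - r) ^ β : ℝ) : ℂ) * ψ x) R
    rw [sub_sub_cancel, sub_zero] at h3
    have h4 : ∀ s : ℝ, R - s - r = R - r - s := fun s => by ring
    simp only [h4] at h3
    rw [h3, intervalIntegral.integral_of_le hrR]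
    refine (setIntegral_eq_of_subset_of_forall_sdiff_eq_zero measurableSet_Ioi Ioc_subset_Ioi_self
      fun x hx => ?_)
    have : R ≤ x := by
      by_contra h
      exact hx.2 ⟨hx.1, (not_le.1 h).le⟩
    rw [hR x this, mul_zero]
  have hΘ2 : ∀ r, 0 < r → R < r → deriv Θ r = 0 := by
    intro r hr hrR
    have : Θ =ᶠ[𝓝 r] fun _ => 0 := by
      filter_upwards [Ioi_mem_nhds hrR] with t ht
      have ht' : R < t := ht
      rw [hΘ t (by linarith)]
      rw [setIntegral_congr_fun (g := fun _ => 0) measurableSet_Ioi, integral_zero]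
      intro x hx
      have hx' : t < x := hx
      simp [hR x (by linarith)]
    rw [this.deriv_eq, deriv_const]
  have hΘ3 : ∀ r ∈ Ioo 0 R, deriv Θ r = -((Real.Gamma (β + 1) : ℂ) * rlIntegral β v (R - r)) := by
    intro r hr
    have d1 := hasDerivAt_integral_of_continuousOn_Ici (sub_pos.2 hr.2)
      (continuousOn_rlIntegral hβ hvc.continuousOn)
    have d2 := ((d1.scomp r ((hasDerivAt_id r).const_sub R)).const_mul
      (Real.Gamma (β + 1) : ℂ))
    have d3 : HasDerivAt Θ ((Real.Gamma (β + 1) : ℂ) * ((-1 : ℝ) • rlIntegral β v (R - r))) r := by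
      refine d2.congr_of_eventuallyEq ?_
      filter_upwards [Ioo_mem_nhds hr.1 hr.2] with t ht using hΘ1 t (by linarith [ht.1]) ht.2.le
    rw [d3.deriv]
    simp
  have hL : ∫ r in Ioi (0 : ℝ), deriv Θ r * Ψ r
      = -((Real.Gamma (β + 1) : ℂ) * ∫ r in (0 : ℝ)..R, Ψ r * rlIntegral β v (R - r)) := by
    rw [← intervalIntegral.integral_const_mul, ← intervalIntegral.integral_neg,
      intervalIntegral.integral_of_le hR0.le]
    rw [setIntegral_eq_of_subset_of_forall_sdiff_eq_zero measurableSet_Ioi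
      (Ioc_subset_Ioi_self : Ioc 0 R ⊆ Ioi 0)]
    · rw [integral_Ioc_eq_integral_Ioo, integral_Ioc_eq_integral_Ioo]
      refine setIntegral_congr_fun measurableSet_Ioo fun r hr => ?_
      simp only [hΘ3 r hr]
      ring
    · intro r hr
      have : R < r := by
        by_contra h
        exact hr.2 ⟨hr.1, not_lt.1 h⟩
      rw [hΘ2 r hr.1 this, zero_mul]
  -- The sign from Θ' cancels the sign in the definition of p, and the symmetry of J^β moves it from
  -- ψ to Ψ.
  rw [hp, hL, neg_neg, integral_mul_rlIntegral_comm hβ hR0.le hΨ ψ.continuous,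
    ← intervalIntegral.integral_const_mul, intervalIntegral.integral_of_le hR0.le]
  have hsupp : ∀ x, x ∉ Ioc 0 R → (Real.Gamma (β + 1) : ℂ) * rlExt β Ψ x * ψ x = 0 := by
    intro x hx
    rcases le_or_gt x 0 with h | h
    · rw [rlExt_of_nonpos h, mul_zero, zero_mul]
    · have : R ≤ x := by
        by_contra h'
        exact hx ⟨h, (not_le.1 h').le⟩
      rw [hR x this, mul_zero]
  rw [← setIntegral_eq_integral_of_forall_compl_eq_zero hsupp]
  refine setIntegral_congr_fun measurableSet_Ioc fun x hx => ?_
  simp only [rlExt_of_nonneg hx.1.le]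
  ring

/-! ### The case p_τ = a δ₀ + g -/

theorem intervalIntegrable_of_exp_mul {s : ℂ} {g : ℝ → ℂ}
    (hg : IntegrableOn (fun r : ℝ => Complex.exp (-s * r) * g r) (Ioi 0)) {t : ℝ} (ht : 0 ≤ t) :
    IntervalIntegrable g volume 0 t := by
  have h1 : IntervalIntegrable (fun r : ℝ => Complex.exp (-s * r) * g r) volume 0 t := by
    rw [intervalIntegrable_iff_integrableOn_Ioc_of_le ht]
    exact hg.mono_set Ioc_subset_Ioi_self
  have h2 := h1.continuousOn_mul (g := fun r : ℝ => Complex.exp (s * r))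
    (by fun_prop : Continuous fun r : ℝ => Complex.exp (s * r)).continuousOn
  refine h2.congr fun r _ => ?_
  rw [← mul_assoc, ← Complex.exp_add, show s * r + -s * r = 0 by ring, Complex.exp_zero, one_mul]

/-- The Laplace transform of a primitive. -/
theorem laplace_primitive {s : ℝ} (hs : 0 < s) {g : ℝ → ℂ}
    (hg : IntegrableOn (fun r : ℝ => Complex.exp (-(s : ℂ) * r) * g r) (Ioi 0)) :
    IntegrableOn (fun x : ℝ => Complex.exp (-(s : ℂ) * x) * ∫ r in (0 : ℝ)..x, g r) (Ioi 0) ∧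
    ∫ x in Ioi (0 : ℝ), Complex.exp (-(s : ℂ) * x) * ∫ r in (0 : ℝ)..x, g r
      = (∫ r in Ioi (0 : ℝ), Complex.exp (-(s : ℂ) * r) * g r) / s := by
  set M : Measure ℝ := volume.restrict (Ioi 0) with hM
  -- Fubini on r < x: integrating e^{-sx} over x > r gives e^{-sr}/s.
  set F : ℝ → ℝ → ℂ := fun x r => (Iio x).indicator (fun r => Complex.exp (-(s : ℂ) * x) * g r) r
    with hF
  have hF' : ∀ x r, F x r = (Ioi r).indicator (fun x : ℝ => Complex.exp (-(s : ℂ) * x) * g r) x := by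
    intro x r
    simp only [hF, indicator, mem_Iio, mem_Ioi]
  have hs' : (-(s : ℂ)).re < 0 := by simpa using hs
  have hgM : AEStronglyMeasurable g M := by
    have h1 : AEStronglyMeasurable
        (fun r : ℝ => Complex.exp ((s : ℂ) * r) * (Complex.exp (-(s : ℂ) * r) * g r)) M :=
      (by fun_prop : Continuous fun r : ℝ => Complex.exp ((s : ℂ) * r)).aestronglyMeasurable.mul
        hg.aestronglyMeasurable
    refine h1.congr (Eventually.of_forall fun r => ?_)
    simp only
    rw [← mul_assoc, ← Complex.exp_add, show (s : ℂ) * r + -s * r = 0 by ring, Complex.exp_zero,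
      one_mul]
  have hmeas : AEStronglyMeasurable (Function.uncurry F) (M.prod M) := by
    have h1 : Function.uncurry F = {p : ℝ × ℝ | p.2 < p.1}.indicator
        (fun p => Complex.exp (-(s : ℂ) * p.1) * g p.2) := by
      ext ⟨x, r⟩
      simp only [Function.uncurry, hF, indicator, mem_Iio, mem_ofPred_eq]
    rw [h1]
    refine AEStronglyMeasurable.indicator ?_ (measurableSet_lt measurable_snd measurable_fst)
    exact (by fun_prop : Continuous fun p : ℝ × ℝ =>
      Complex.exp (-(s : ℂ) * p.1)).aestronglyMeasurable.mul hgM.comp_snd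
  have hIoi : ∀ r : ℝ, 0 < r → Ioi 0 ∩ Ioi r = Ioi r := fun r hr =>
    inter_eq_right.2 (Ioi_subset_Ioi hr.le)
  have hint : Integrable (Function.uncurry F) (M.prod M) := by
    rw [integrable_prod_iff' hmeas]
    constructor
    · filter_upwards [ae_restrict_mem measurableSet_Ioi] with r hr
      simp only [Function.uncurry_apply_pair, hF']
      rw [integrable_indicator_iff measurableSet_Ioi, IntegrableOn, hM,
        Measure.restrict_restrict measurableSet_Ioi, inter_comm, hIoi r hr]
      exact (integrableOn_exp_mul_complex_Ioi hs' r).mul_const _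
    · have h1 : Integrable (fun r : ℝ => ‖Complex.exp (-(s : ℂ) * r) * g r‖ / s) M :=
        hg.norm.div_const _
      refine h1.congr ?_
      filter_upwards [ae_restrict_mem measurableSet_Ioi] with r hr
      simp only [Function.uncurry_apply_pair, hF', norm_indicator_eq_indicator_norm, norm_mul]
      rw [hM, setIntegral_indicator measurableSet_Ioi, hIoi r hr, integral_mul_const]
      have h2 : ∀ x : ℝ, ‖Complex.exp (-(s : ℂ) * x)‖ = Real.exp (-s * x) := fun x => by
        simp [Complex.norm_exp]
      simp only [h2]
      rw [integral_exp_mul_Ioi (by linarith)]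
      field_simp
  have hrow : ∀ x ∈ Ioi (0 : ℝ), ∫ r, F x r ∂M
      = Complex.exp (-(s : ℂ) * x) * ∫ r in (0 : ℝ)..x, g r := by
    intro x hx
    simp only [hF]
    rw [hM, setIntegral_indicator measurableSet_Iio, Ioi_inter_Iio, integral_const_mul,
      ← integral_Ioc_eq_integral_Ioo, ← intervalIntegral.integral_of_le (le_of_lt hx)]
  have hcol : ∀ r ∈ Ioi (0 : ℝ), ∫ x, F x r ∂M = Complex.exp (-(s : ℂ) * r) * g r / s := by
    intro r hr
    simp only [hF']
    rw [hM, setIntegral_indicator measurableSet_Ioi, hIoi r hr, integral_mul_const,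
      integral_exp_mul_complex_Ioi hs', neg_div_neg_eq]
    ring
  constructor
  · refine hint.integral_prod_left.congr ?_
    filter_upwards [ae_restrict_mem measurableSet_Ioi] with x hx using hrow x hx
  · have hswap := integral_integral_swap hint
    rw [← setIntegral_congr_fun measurableSet_Ioi hrow, hswap,
      setIntegral_congr_fun measurableSet_Ioi hcol, integral_div]

/-- The vanishing transforms kill every exponential sum, and these approximate h uniformly on [0,∞),
so the pairing is at most ε‖w‖₁ for every ε. -/
theorem integral_mul_eq_zero_of_laplace {w : ℝ → ℂ} (hw : IntegrableOn w (Ioi 0))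
    (h0 : ∀ n : ℕ, ∫ r in Ioi (0 : ℝ), Complex.exp (-((n : ℂ) + 1) * r) * w r = 0) {h : ℝ → ℂ}
    (hc : Continuous h) {T : ℝ} (hT : ∀ t, T < t → h t = 0) :
    ∫ r in Ioi (0 : ℝ), h r * w r = 0 := by
  have hexp : ∀ n : ℕ, IntegrableOn (fun r : ℝ => Complex.exp (-((n : ℂ) + 1) * r) * w r)
      (Ioi 0) := by
    intro n
    refine Integrable.bdd_mul (c := 1) hw (by fun_prop) ?_
    filter_upwards [ae_restrict_mem measurableSet_Ioi] with r hr
    have hr' : 0 < r := hr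
    rw [Complex.norm_exp, Real.exp_le_one_iff]
    have : (-((n : ℂ) + 1) * (r : ℂ)).re = -(((n : ℝ) + 1) * r) := by simp; ring
    rw [this, neg_nonpos]
    positivity
  have hsum : ∀ N a, (fun r => expSum N a r * w r)
      = fun r : ℝ => ∑ n ∈ Finset.range N, a n * (Complex.exp (-((n : ℂ) + 1) * r) * w r) := by
    intro N a
    ext r
    simp only [expSum, Finset.sum_mul, mul_assoc]
  have hEi : ∀ N a, IntegrableOn (fun r => expSum N a r * w r) (Ioi 0) := by
    intro N a
    rw [hsum]
    exact integrable_finsetSum _ fun n _ => (hexp n).const_mul _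
  have hE : ∀ N a, ∫ r in Ioi (0 : ℝ), expSum N a r * w r = 0 := by
    intro N a
    rw [hsum, integral_finsetSum _ fun n _ => (hexp n).const_mul _]
    refine Finset.sum_eq_zero fun n _ => ?_
    rw [integral_const_mul, h0, mul_zero]
  have key : ∀ ε > 0, ‖∫ r in Ioi (0 : ℝ), h r * w r‖ ≤ ε * ∫ r in Ioi (0 : ℝ), ‖w r‖ := by
    intro ε hε
    obtain ⟨N, a, hNa⟩ := exists_expSum_near h hc T hT 0 ε hε
    have hb : ∀ r ∈ Ioi (0 : ℝ), ‖expSum N a r - h r‖ ≤ ε := by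
      intro r hr
      have hr' : 0 < r := hr
      refine (hNa r hr'.le).trans (mul_le_of_le_one_right hε.le ?_)
      exact Real.exp_le_one_iff.2 (by linarith)
    have hi : IntegrableOn (fun r => (expSum N a r - h r) * w r) (Ioi 0) := by
      refine Integrable.bdd_mul (c := ε) hw
        ((contDiff_expSum N a).continuous.sub hc).aestronglyMeasurable ?_
      filter_upwards [ae_restrict_mem measurableSet_Ioi] with r hr using hb r hr
    have e : ∫ r in Ioi (0 : ℝ), h r * w r
        = -∫ r in Ioi (0 : ℝ), (expSum N a r - h r) * w r := by
      have : ∀ r, h r * w r = expSum N a r * w r - (expSum N a r - h r) * w r := fun r => by ring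
      simp_rw [this]
      rw [integral_sub (hEi N a) hi, hE, zero_sub]
    rw [e, norm_neg, ← integral_const_mul]
    refine norm_integral_le_of_norm_le (hw.norm.const_mul ε) ?_
    filter_upwards [ae_restrict_mem measurableSet_Ioi] with r hr
    rw [norm_mul]
    exact mul_le_mul_of_nonneg_right (hb r hr) (norm_nonneg _)
  have hlim : Tendsto (fun ε : ℝ => ε * ∫ r in Ioi (0 : ℝ), ‖w r‖) (𝓝[>] 0) (𝓝 0) := by
    have : Tendsto (fun ε : ℝ => ε * ∫ r in Ioi (0 : ℝ), ‖w r‖) (𝓝 0)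
        (𝓝 (0 * ∫ r in Ioi (0 : ℝ), ‖w r‖)) := tendsto_id.mul_const _
    rw [zero_mul] at this
    exact this.mono_left nhdsWithin_le_nhds
  have : ‖∫ r in Ioi (0 : ℝ), h r * w r‖ ≤ 0 := by
    refine ge_of_tendsto hlim ?_
    filter_upwards [self_mem_nhdsWithin] with ε hε using key ε hε
  exact norm_le_zero_iff.1 this

/-- A continuous function is determined by its Laplace transform at an arithmetic progression. -/
theorem eqOn_zero_of_laplace {H : ℝ → ℂ} (hH : ContinuousOn H (Ici 0)) (s : ℝ)
    (hi : IntegrableOn (fun r : ℝ => Complex.exp (-(s : ℂ) * r) * H r) (Ioi 0))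
    (h0 : ∀ n : ℕ, ∫ r in Ioi (0 : ℝ), Complex.exp (-((s + (n + 1) : ℝ) : ℂ) * r) * H r = 0) :
    EqOn H 0 (Ici 0) := by
  set w : ℝ → ℂ := fun r => Complex.exp (-(s : ℂ) * r) * H r with hw
  have h0' : ∀ n : ℕ, ∫ r in Ioi (0 : ℝ), Complex.exp (-((n : ℂ) + 1) * r) * w r = 0 := by
    intro n
    rw [← h0 n]
    refine integral_congr_ae (Eventually.of_forall fun r => ?_)
    simp only [hw]
    rw [← mul_assoc, ← Complex.exp_add]
    congr 2
    push_cast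
    ring
  -- The weight e^{-sr} makes w integrable; orthogonality to all test functions gives w = 0 a.e.,
  -- and continuity of H upgrades this to every point.
  have hae : ∀ᵐ r : ℝ, r ∈ Ioi (0 : ℝ) → w r = 0 := by
    refine isOpen_Ioi.ae_eq_zero_of_integral_contDiff_smul_eq_zero hi.locallyIntegrableOn
      fun g hg hgc hgs => ?_
    obtain ⟨T, hT⟩ := hgc.isCompact.bddAbove
    have hgz : ∀ t, T < t → (g t : ℂ) = 0 := fun t ht => by
      rw [image_eq_zero_of_notMem_tsupport fun h => absurd (hT h) (not_le.2 ht), Complex.ofReal_zero]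
    rw [← integral_mul_eq_zero_of_laplace hi h0' (Complex.continuous_ofReal.comp hg.continuous) hgz]
    rw [setIntegral_eq_integral_of_forall_compl_eq_zero]
    · rfl
    · intro t ht
      have : g t = 0 := image_eq_zero_of_notMem_tsupport fun h => ht (hgs h)
      simp [this]
  refine Measure.eqOn_of_ae_eq (μ := volume) ?_ hH continuousOn_const (by rw [interior_Ici, closure_Ioi])
  rw [← Measure.restrict_congr_set Ioi_ae_eq_Ici]
  refine (ae_restrict_iff' measurableSet_Ioi).2 ?_
  filter_upwards [hae] with r hr hr0
  exact (mul_eq_zero.1 (hr hr0)).resolve_left (Complex.exp_ne_zero _)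

theorem continuousOn_primitive_Ici {g : ℝ → ℂ}
    (hg : ∀ t, 0 ≤ t → IntervalIntegrable g volume 0 t) :
    ContinuousOn (fun x => ∫ r in (0 : ℝ)..x, g r) (Ici 0) := by
  intro x hx
  have hx' : 0 ≤ x := hx
  have hx1 : 0 ≤ x + 1 := by linarith
  have h1 : IntegrableOn g (uIcc 0 (x + 1)) := by
    have := hg (x + 1) hx1
    rw [uIcc_of_le hx1, integrableOn_Icc_iff_integrableOn_Ioc]
    rwa [intervalIntegrable_iff_integrableOn_Ioc_of_le hx1] at this
  have h2 := intervalIntegral.continuousOn_primitive_interval h1 x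
    (by rw [uIcc_of_le hx1]; exact ⟨hx', by linarith⟩)
  refine h2.mono_of_mem_nhdsWithin ?_
  rw [uIcc_of_le hx1]
  rw [← Ici_inter_Iic]
  exact inter_mem_nhdsWithin _ (Iic_mem_nhds (by linarith))

/-- If the inverse Laplace transform of the history is `a δ₀ + g`, its primitive is the delayed
history. -/
theorem add_primitive_eq_shiftedHistory {τ : ℝ} (hτ : 0 < τ) {φ : ℝ → ℂ}
    (hφ : ContinuousOn φ (Icc (-τ) 0)) {a : ℂ} {g : ℝ → ℂ} {σ : ℝ}
    (hg : ∀ s : ℂ, σ < s.re →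
      IntegrableOn (fun r : ℝ => Complex.exp (-s * r) * g r) (Ioi 0) ∧
      a + ∫ r in Ioi (0 : ℝ), Complex.exp (-s * r) * g r = historyTransform τ φ s) :
    ∀ x, 0 ≤ x → a + ∫ r in (0 : ℝ)..x, g r = shiftedHistory τ φ x := by
  obtain ⟨C, hC⟩ := exists_bound_shiftedHistory hτ.le hφ
  have hΨ := continuousOn_shiftedHistory hτ.le hφ
  have hloc : ∀ t, 0 ≤ t → IntervalIntegrable g volume 0 t := fun t ht =>
    intervalIntegrable_of_exp_mul (hg ((σ + 1 : ℝ) : ℂ) (by simp)).1 ht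
  set H : ℝ → ℂ := fun x => a + (∫ r in (0 : ℝ)..x, g r) - shiftedHistory τ φ x with hH
  have hHc : ContinuousOn H (Ici 0) :=
    (continuousOn_const.add (continuousOn_primitive_Ici hloc)).sub hΨ
  have main : ∀ s : ℝ, 0 < s → σ < s →
      IntegrableOn (fun r : ℝ => Complex.exp (-(s : ℂ) * r) * H r) (Ioi 0) ∧
      ∫ r in Ioi (0 : ℝ), Complex.exp (-(s : ℂ) * r) * H r = 0 := by
    intro s hs hσ
    have hre : 0 < (s : ℂ).re := by simpa using hs
    have hs0 : (s : ℂ) ≠ 0 := by exact_mod_cast hs.ne'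
    have hs' : (-(s : ℂ)).re < 0 := by simpa using hs
    obtain ⟨g1, g2⟩ := hg s (by simpa using hσ)
    obtain ⟨p1, p2⟩ := laplace_primitive hs g1
    have i1 : IntegrableOn (fun r : ℝ => Complex.exp (-(s : ℂ) * r) * a) (Ioi 0) :=
      (integrableOn_exp_mul_complex_Ioi hs' 0).mul_const a
    have i2 := integrableOn_exp_mul_of_bound hΨ hC hre
    have e : ∀ r : ℝ, Complex.exp (-(s : ℂ) * r) * H r
        = Complex.exp (-(s : ℂ) * r) * a + Complex.exp (-(s : ℂ) * r) * (∫ r in (0 : ℝ)..r, g r)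
          - Complex.exp (-(s : ℂ) * r) * shiftedHistory τ φ r := fun r => by
      simp only [hH]; ring
    simp only [e]
    have i3 : IntegrableOn (fun r : ℝ => Complex.exp (-(s : ℂ) * r) * a
        + Complex.exp (-(s : ℂ) * r) * ∫ r in (0 : ℝ)..r, g r) (Ioi 0) := i1.add p1
    refine ⟨i3.sub i2, ?_⟩
    have l := laplace_shiftedHistory hτ hφ hre
    rw [← g2] at l
    rw [integral_sub i3 i2, integral_add i1 p1, p2, integral_mul_const,
      integral_exp_mul_complex_Ioi hs']
    simp only [Complex.ofReal_zero, mul_zero, Complex.exp_zero, neg_div_neg_eq]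
    generalize (∫ r in Ioi (0 : ℝ), Complex.exp (-(s : ℂ) * r) * shiftedHistory τ φ r) = A at l ⊢
    generalize (∫ r in Ioi (0 : ℝ), Complex.exp (-(s : ℂ) * r) * g r) = B at l ⊢
    field_simp
    linear_combination -l
  -- The abscissa max(σ, 0) + 1 lies in both half-planes: the one where g is transformable and the
  -- one where Ψ is.
  have hz := eqOn_zero_of_laplace hHc (max σ 0 + 1)
    (main _ (by positivity) (by linarith [le_max_left σ 0])).1
    (fun n => (main (max σ 0 + 1 + (n + 1)) (by positivity)
      (by have : (0 : ℝ) ≤ n := n.cast_nonneg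
          linarith [le_max_left σ 0])).2)
  intro x hx
  exact sub_eq_zero.1 (hz hx)

/-- Apply J^β to Ψ = a + J^1 g: the constant gives a x^β / Γ(β+1), and J^β J^1 g = J^{β+1} g has
kernel (x - r)^β / Γ(β+1). -/
theorem integral_rpow_mul_eq_rlIntegral {τ : ℝ} (hτ : 0 < τ) {φ : ℝ → ℂ}
    (hφ : ContinuousOn φ (Icc (-τ) 0)) {a : ℂ} {g : ℝ → ℂ} {σ : ℝ}
    (hg : ∀ s : ℂ, σ < s.re →
      IntegrableOn (fun r : ℝ => Complex.exp (-s * r) * g r) (Ioi 0) ∧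
      a + ∫ r in Ioi (0 : ℝ), Complex.exp (-s * r) * g r = historyTransform τ φ s)
    {β x : ℝ} (hβ : 0 < β) (hx : 0 ≤ x) :
    a * ((x ^ β : ℝ) : ℂ) + ∫ r in (0 : ℝ)..x, (((x - r) ^ β : ℝ) : ℂ) * g r
      = (Real.Gamma (β + 1) : ℂ) * rlIntegral β (shiftedHistory τ φ) x := by
  have hloc : ∀ t, 0 ≤ t → IntervalIntegrable g volume 0 t := fun t ht =>
    intervalIntegrable_of_exp_mul (hg ((σ + 1 : ℝ) : ℂ) (by simp)).1 ht
  have hG : (Real.Gamma (β + 1) : ℂ) ≠ 0 := by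
    exact_mod_cast (Real.Gamma_pos_of_pos (by linarith)).ne'
  obtain ⟨k1, k2⟩ := rlIntegral_rlIntegral hβ one_pos hx (hloc x hx)
    (intervalIntegrable_kernel_mul_of_one_le (by linarith) (hloc x hx))
  have hprim : ∀ r ∈ Icc 0 x, shiftedHistory τ φ r = a + rlIntegral 1 g r := by
    intro r hr
    rw [rlIntegral_one, add_primitive_eq_shiftedHistory hτ hφ hg r hr.1]
  have hconst : (Real.Gamma (β + 1) : ℂ) * rlIntegral β (fun _ => a) x = a * ((x ^ β : ℝ) : ℂ) := by
    have h1 : ∫ r in (0 : ℝ)..x, (x - r) ^ (β - 1) = x ^ β / β := by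
      rw [intervalIntegral.integral_comp_sub_left (fun r => r ^ (β - 1)) x, sub_self, sub_zero,
        integral_rpow (Or.inl (by linarith)), sub_add_cancel, Real.zero_rpow hβ.ne', sub_zero]
    have hGβ : (Real.Gamma β : ℂ) ≠ 0 := by exact_mod_cast (Real.Gamma_pos_of_pos hβ).ne'
    have hβ0 : (β : ℂ) ≠ 0 := by exact_mod_cast hβ.ne'
    rw [rlIntegral, intervalIntegral.integral_mul_const, intervalIntegral.integral_ofReal, h1,
      Real.Gamma_add_one hβ.ne']
    push_cast
    field_simp
  rw [rlIntegral_congr hx hprim,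
    rlIntegral_add (intervalIntegrable_kernel_mul hβ hx continuousOn_const) k1, k2, mul_add, hconst]
  congr 1
  rw [rlIntegral, ← mul_assoc, mul_one_div_cancel hG, one_mul, add_sub_cancel_right]

end FDDE

/-! ### Assembly of the main theorem -/

theorem mainTheorem2 (α τ : ℝ) (hα0 : 0 < α) (hα1 : α < 1) (hτ : 0 < τ) (lam : ℂ)
    (φ f : ℝ → ℂ) (hφ : ContinuousOn φ (Icc (-τ) 0)) (hf : ContinuousOn f (Ici 0)) :
    (∃! p : 𝓢'(ℝ, ℂ), FDDE.IsInverseLaplace p (FDDE.historyTransform τ φ)) ∧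
    ∀ p : 𝓢'(ℝ, ℂ), FDDE.IsInverseLaplace p (FDDE.historyTransform τ φ) →
      ∃ (c : ℕ → ℝ → ℂ) (Y : ℝ → ℂ),
        (∀ k : ℕ, FDDE.IsPowerConvolution p ((k + 1) * α) (c k)) ∧
        (∀ t : ℝ, 0 ≤ t →
          Y t = φ 0
            + ∑ k ∈ Finset.range (⌊t / τ⌋₊ + 1),
                lam ^ (k + 1) / (Real.Gamma ((k + 1) * α + 1) : ℂ) * c k (t - k * τ)
            + FDDE.genIntegral α τ lam f t) ∧
        FDDE.IsContinuousSolution α τ lam φ f Y ∧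
        (∀ y : ℝ → ℂ, FDDE.IsContinuousSolution α τ lam φ f y → EqOn y Y (Ici (-τ))) ∧
        (∀ y : ℝ → ℂ, FDDE.IsCaputoSolution α τ lam φ f y → EqOn y Y (Ici (-τ))) ∧
        (FDDE.LocallyAC Y → FDDE.IsCaputoSolution α τ lam φ f Y) ∧
        (∀ (a : ℂ) (g : ℝ → ℂ) (σ : ℝ),
          (∀ s : ℂ, σ < s.re →
            IntegrableOn (fun r : ℝ => Complex.exp (-s * r) * g r) (Ioi 0) ∧
            a + ∫ r in Ioi (0 : ℝ), Complex.exp (-s * r) * g r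
              = FDDE.historyTransform τ φ s) →
          ∀ t : ℝ, 0 ≤ t →
            Y t = φ 0
              + ∑ k ∈ Finset.range (⌊t / τ⌋₊ + 1),
                  lam ^ (k + 1) / (Real.Gamma ((k + 1) * α + 1) : ℂ) *
                    (a * (((t - k * τ) ^ ((k + 1) * α) : ℝ) : ℂ)
                      + ∫ r in (0 : ℝ)..(t - k * τ),
                          (((t - k * τ - r) ^ ((k + 1) * α) : ℝ) : ℂ) * g r)
              + FDDE.genIntegral α τ lam f t) := by
  have hΨ := FDDE.continuousOn_shiftedHistory hτ.le hφ
  obtain ⟨C, hC⟩ := FDDE.exists_bound_shiftedHistory hτ.le hφ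
  obtain ⟨q, hq⟩ := FDDE.exists_distribution_deriv _ hΨ C hC
  have hqL := FDDE.isInverseLaplace_of_shiftedHistory hτ hφ hq
  have hsol := FDDE.isContinuousSolution_delaySolution (lam := lam) hα0 hα1 hτ hφ hf
  have hnonneg : ∀ t : ℝ, 0 ≤ t → ∀ k ∈ Finset.range (⌊t / τ⌋₊ + 1), 0 ≤ t - k * τ := by
    intro t ht k hk
    have hk' : (k : ℝ) ≤ t / τ :=
      (Nat.le_floor_iff (by positivity)).1 (Nat.lt_succ_iff.1 (Finset.mem_range.1 hk))
    rw [le_div_iff₀ hτ] at hk'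
    exact sub_nonneg.2 hk'
  have hpos : ∀ k : ℕ, 0 < ((k : ℝ) + 1) * α := fun k => by positivity
  have hG : ∀ k : ℕ, (Real.Gamma ((k + 1) * α + 1) : ℂ) ≠ 0 := fun k => by
    exact Complex.ofReal_ne_zero.2 (Real.Gamma_pos_of_pos (by linarith [hpos k])).ne'
  refine ⟨⟨q, hqL, fun p hp => hp.unique hqL⟩, fun p hp => ?_⟩
  -- By uniqueness the given p is the derivative of Ψ, so the explicit convolutions Γ((k+1)α+1)
  -- J^{(k+1)α} Ψ are available for it.
  obtain rfl := hp.unique hqL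
  refine ⟨fun k x => (Real.Gamma ((k + 1) * α + 1) : ℂ)
      * FDDE.rlExt ((k + 1) * α) (FDDE.shiftedHistory τ φ) x,
    FDDE.delaySolution α τ lam φ f, fun k => FDDE.isPowerConvolution_rlExt hΨ hq (hpos k),
    fun t ht => ?_, hsol, fun y hy => hy.unique hα0 hα1 hτ hf hsol,
    fun y hy => (hy.isContinuousSolution hα1 hf).unique hα0 hα1 hτ hf hsol,
    fun hac => hsol.isCaputoSolution hα1 hac, fun a g σ hg t ht => ?_⟩
  · rw [FDDE.delaySolution_formula hα0 hτ hφ hf ht]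
    congr 2
    refine Finset.sum_congr rfl fun k hk => ?_
    beta_reduce
    rw [FDDE.rlExt_of_nonneg (hnonneg t ht k hk), ← mul_assoc, div_mul_cancel₀ _ (hG k)]
  · rw [FDDE.delaySolution_formula hα0 hτ hφ hf ht]
    congr 2
    refine Finset.sum_congr rfl fun k hk => ?_
    rw [FDDE.integral_rpow_mul_eq_rlIntegral hτ hφ hg (hpos k) (hnonneg t ht k hk), ← mul_assoc,
      div_mul_cancel₀ _ (hG k)]
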